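/- Let $(\Omega,\mathcal F,\mu)$ be a probability space, let $(X_n)_{n\ge1}\subset L_2(\Omega,\mu)$ be a sequence of centered independent complex random variables, and let $(\mathbf j_n)_{n\ge1}\subset\mathbf N^s$, $\mathbf j_n=(j_n^{(1)},\dots,j_n^{(s)})$. Put $|\mathbf j_n|^*=\max_{1\le k\le n}\max_{1\le i\le s}j_k^{(i)}$ and $a\vee b=\max\{a,b\}$, and assume that $$\sum_{n=1}^\infty\|X_n\|_2^2\,\log(n\vee|\mathbf j_n|^*)\,(\log n)^2<\infty .$$ Then there is a set $\Omega^*\subset\Omega$ of full measure such that for every $\omega\in\Omega^*$ there is a constant $K_\omega<\infty$ with the following property. For every probability space $(Y,\Sigma,\pi)$, every family $V_1,\dots,V_s$ of pairwise commuting linear isometries of the complex space $L_2(Y,\pi)$ and every $f\in L_2(Y,\pi)$, the series $$\sum_{n=1}^\infty X_n(\omega)\,V^{\mathbf j_n}f,\qquad V^{\mathbf j}:=V_1^{j^{(1)}}\circ\cdots\circ V_s^{j^{(s)}},$$ converges $\pi$-a.e., and $$\Bigl\|\sup_{n\ge1}\Bigl|\sum_{k=1}^nX_k(\omega)V^{\mathbf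 j_k}f\Bigr|\Bigr\|_{L_2(\pi)}\le K_\omega\|f\|_{L_2(\pi)} .$$ -/

import Mathlib

open MeasureTheory ProbabilityTheory Filter Topology
open scoped NNReal ENNReal

/-- The running maximum `|j_n|^*`, that is, the maximum of the coordinates `j_k^{(i)}` over all
indices `k ≤ n` and all `i`, for a sequence `j` of vectors of natural numbers. -/
def runningMax {s : ℕ} (j : ℕ → Fin s → ℕ) (n : ℕ) : ℕ :=
  (Finset.range (n + 1)).sup fun k => Finset.univ.sup (j k)

/-- The isometry `V^a = V_1^{a_1} ∘ ⋯ ∘ V_s^{a_s}` of `L_2(Y, ν)`, composed in this order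
(multiplication of linear isometries is composition). -/
noncomputable def isometryPow {Y : Type*} [MeasurableSpace Y] {ν : Measure Y} {s : ℕ}
    (V : Fin s → (Lp ℂ 2 ν →ₗᵢ[ℂ] Lp ℂ 2 ν)) (a : Fin s → ℕ) : Lp ℂ 2 ν →ₗᵢ[ℂ] Lp ℂ 2 ν :=
  (List.ofFn fun i => V i ^ a i).prod

/-- The partial sum with the terms of index `0, …, n` of the series `∑ c_k V^{j_k} f`,
as a function on `Y`. -/
noncomputable def weightedSum {Y : Type*} [MeasurableSpace Y] {ν : Measure Y} {s : ℕ}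
    (c : ℕ → ℂ) (V : Fin s → (Lp ℂ 2 ν →ₗᵢ[ℂ] Lp ℂ 2 ν)) (j : ℕ → Fin s → ℕ) (f : Lp ℂ 2 ν)
    (n : ℕ) (y : Y) : ℂ :=
  ∑ k ∈ Finset.range (n + 1), c k * isometryPow V (j k) f y

/-! The two logarithmic factors have separate sources: `log (n ∨ |j_n|^*)` pays for uniformity in
the isometries, `(log n)^2` for the maximal function.

Uniformity: transference to the finite group `(ℤ/2D)^s` bounds a polynomial of degree below `D` in
commuting isometries by its maximum over the `(2D)^s` characters (`norm_sq_sum_isometryPow_le`).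
This maximum involves only `ω`. A maximum over at most `2^m` indices is dominated by an `ℓ^{2m}`
norm, and `ℓ^{2m}` is `2`-smooth with constant `O(m)`. The resulting type `2` inequality bounds the
second moment of the maximum by `O(m)` times the sum of the variances
(`lintegral_iSup_enorm_sum_sq_le`), with `m` of order `log D`.

Maximal function: indices are grouped into levels on which `log (n ∨ |j_n|^*)` is constant up to a
factor `2`, and each initial segment is cut in the Rademacher–Menshov manner into complete levels
and dyadic blocks (`enorm_sum_range_sq_le_chainSum`). Integrating over `Y` and then over `Ω` gives a
random constant of finite mean (`chainSum_le`, `exists_bound_iSup_weightedSum`).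

Convergence: the same bound for the tails of the series has constants whose means tend to `0`, so
their infimum vanishes almost surely and the partial sums are Cauchy. -/

/-! ### Transference from commuting isometries to finite abelian groups -/

theorem List.prod_ofFn_mul_of_commute {M : Type*} [Monoid M] :
    ∀ {s : ℕ} (x y : Fin s → M), (∀ i k, Commute (x i) (y k)) →
      (List.ofFn fun i => x i * y i).prod = (List.ofFn x).prod * (List.ofFn y).prod
  | 0, _, _, _ => by simp
  | s + 1, x, y, h => by
    have ih := List.prod_ofFn_mul_of_commute (fun i => x (Fin.succ i)) (fun i => y (Fin.succ i))
      fun i k => h _ _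
    have hc : Commute (y 0) (List.ofFn fun i : Fin s => x (Fin.succ i)).prod := by
      refine Commute.list_prod_right _ _ fun a ha => ?_
      obtain ⟨i, rfl⟩ := List.mem_ofFn.1 ha
      exact (h _ _).symm
    simp only [List.ofFn_succ, List.prod_cons]
    rw [ih, mul_assoc, mul_assoc, ← mul_assoc (y 0), hc.eq, mul_assoc]

/-- Commutativity of the `V i` enters the proof only here. -/
theorem isometryPow_add {Y : Type*} [MeasurableSpace Y] {ν : Measure Y} {s : ℕ}
    {V : Fin s → (Lp ℂ 2 ν →ₗᵢ[ℂ] Lp ℂ 2 ν)} (hV : ∀ i k, Commute (V i) (V k))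
    (a b : Fin s → ℕ) : isometryPow V (a + b) = isometryPow V a * isometryPow V b := by
  unfold isometryPow
  rw [← List.prod_ofFn_mul_of_commute _ _ fun i k => (hV i k).pow_pow _ _]
  simp [pow_add]

/-- Parseval's identity on a finite abelian group for functions with values in a Hilbert space. -/
theorem sum_addChar_norm_sq_sum_smul {G H : Type*} [AddCommGroup G] [Fintype G]
    [NormedAddCommGroup H] [InnerProductSpace ℂ H] (F : G → H) :
    ∑ χ : AddChar G ℂ, ‖∑ c, χ c • F c‖ ^ 2 = Fintype.card G * ∑ c, ‖F c‖ ^ 2 := by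
  classical
  have key : ((∑ χ : AddChar G ℂ, ‖∑ c, χ c • F c‖ ^ 2 : ℝ) : ℂ)
      = ((Fintype.card G * ∑ c, ‖F c‖ ^ 2 : ℝ) : ℂ) := by
    push_cast
    have h1 : ∀ χ : AddChar G ℂ, ((‖∑ c, χ c • F c‖ : ℂ)) ^ 2
        = ∑ c, ∑ c', χ (c' - c) * inner ℂ (F c) (F c') := by
      intro χ
      have := inner_self_eq_norm_sq_to_K (𝕜 := ℂ) (∑ c, χ c • F c)
      rw [show ((‖∑ c, χ c • F c‖ : ℂ)) ^ 2 = inner ℂ (∑ c, χ c • F c) (∑ c, χ c • F c) from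
        this.symm]
      rw [sum_inner]
      refine Finset.sum_congr rfl fun c _ => ?_
      rw [inner_sum]
      refine Finset.sum_congr rfl fun c' _ => ?_
      rw [inner_smul_left, inner_smul_right, sub_eq_add_neg, AddChar.map_add_eq_mul,
        AddChar.map_neg_eq_conj]
      ring
    simp_rw [h1]
    rw [Finset.sum_comm, Finset.mul_sum]
    refine Finset.sum_congr rfl fun c _ => ?_
    rw [Finset.sum_comm]
    simp_rw [← Finset.sum_mul, AddChar.sum_apply_eq_ite, sub_eq_zero]
    simp [inner_self_eq_norm_sq_to_K]
  exact_mod_cast key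

/-- Convolution with a finite combination of point masses on a finite abelian group is bounded on
square-summable Hilbert space valued functions by the supremum of its Fourier transform. -/
theorem sum_norm_sq_sum_smul_translate_le {G H κ : Type*} [AddCommGroup G] [Fintype G]
    [NormedAddCommGroup H] [InnerProductSpace ℂ H] (F : G → H) (t : Finset κ) (a : κ → ℂ)
    (g : κ → G) {B : ℝ} (hB : ∀ χ : AddChar G ℂ, ‖∑ k ∈ t, a k * χ (-g k)‖ ^ 2 ≤ B) :
    ∑ c, ‖∑ k ∈ t, a k • F (c + g k)‖ ^ 2 ≤ B * ∑ c, ‖F c‖ ^ 2 := by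
  have hG : (0 : ℝ) < Fintype.card G := by exact_mod_cast Fintype.card_pos
  refine le_of_mul_le_mul_left ?_ hG
  rw [← sum_addChar_norm_sq_sum_smul, mul_left_comm, ← sum_addChar_norm_sq_sum_smul,
    Finset.mul_sum]
  refine Finset.sum_le_sum fun χ _ => ?_
  -- Translation by `g k` becomes multiplication by `χ (-g k)` on the Fourier side, so Parseval on
  -- both sides finishes the proof.
  have : ∑ c, χ c • ∑ k ∈ t, a k • F (c + g k)
      = (∑ k ∈ t, a k * χ (-g k)) • ∑ c, χ c • F c := by
    rw [Finset.sum_smul]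
    simp_rw [Finset.smul_sum]
    rw [Finset.sum_comm]
    refine Finset.sum_congr rfl fun k _ => ?_
    rw [← Equiv.sum_comp (Equiv.addRight (g k)) fun c => (a k * χ (-g k)) • χ c • F c]
    refine Finset.sum_congr rfl fun c _ => ?_
    simp only [Equiv.coe_addRight, smul_smul]
    congr 1
    rw [mul_assoc, ← AddChar.map_add_eq_mul, mul_comm, add_comm c, neg_add_cancel_left]
  rw [this, norm_smul, mul_pow]
  exact mul_le_mul_of_nonneg_right (hB χ) (by positivity)

/-- A polynomial of degree less than `D` in each of `s` commuting isometries is bounded, up to the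
factor `2 ^ (s / 2)`, by its maximum on the characters of `(ℤ / 2D) ^ s`. -/
theorem norm_sq_sum_isometryPow_le {Y : Type*} [MeasurableSpace Y] {ν : Measure Y} {s : ℕ}
    {V : Fin s → (Lp ℂ 2 ν →ₗᵢ[ℂ] Lp ℂ 2 ν)} (hV : ∀ i k, Commute (V i) (V k))
    {D : ℕ} [NeZero D] (t : Finset ℕ) (a : ℕ → ℂ) {j : ℕ → Fin s → ℕ}
    (hj : ∀ k ∈ t, ∀ i, j k i < D) {B : ℝ}
    (hB : ∀ χ : AddChar (Fin s → ZMod (2 * D)) ℂ,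
      ‖∑ k ∈ t, a k * χ (-fun i => (j k i : ZMod (2 * D)))‖ ^ 2 ≤ B) (f : Lp ℂ 2 ν) :
    ‖∑ k ∈ t, a k • isometryPow V (j k) f‖ ^ 2 ≤ 2 ^ s * B * ‖f‖ ^ 2 := by
  classical
  have hD : 0 < D := Nat.pos_of_ne_zero (NeZero.ne D)
  let F : (Fin s → ZMod (2 * D)) → Lp ℂ 2 ν := fun c => isometryPow V (fun i => (c i).val) f
  have h := sum_norm_sq_sum_smul_translate_le F t a _ hB
  have hF : ∀ c, ‖F c‖ = ‖f‖ := fun c => (isometryPow V _).norm_map f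
  simp only [hF, Finset.sum_const, Finset.card_univ, Fintype.card_fun, ZMod.card, Fintype.card_fin,
    nsmul_eq_mul] at h
  -- For base points in `[0, D)^s`, adding an exponent below `D` does not wrap around modulo `2D`,
  -- so an isometry factors out. These are `D^s` of the `(2D)^s` points, whence the factor `2^s`.
  let e : (Fin s → Fin D) → (Fin s → ZMod (2 * D)) := fun c i => ((c i : ℕ) : ZMod (2 * D))
  have hval : ∀ n, n < 2 * D → ((n : ZMod (2 * D))).val = n := fun n hn => ZMod.val_cast_of_lt hn
  have he : Function.Injective e := by
    intro c c' hcc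
    funext i
    have := congrArg ZMod.val (congrFun hcc i)
    simp only [e] at this
    rw [hval _ (by omega), hval _ (by omega)] at this
    exact Fin.ext this
  have hterm : ∀ c, ‖∑ k ∈ t, a k • F (e c + fun i => (j k i : ZMod (2 * D)))‖ ^ 2
      = ‖∑ k ∈ t, a k • isometryPow V (j k) f‖ ^ 2 := by
    intro c
    rw [← (isometryPow V fun i => (c i : ℕ)).norm_map (∑ k ∈ t, a k • isometryPow V (j k) f),
      map_sum]
    congr 2
    refine Finset.sum_congr rfl fun k hk => ?_
    rw [map_smul, ← Function.comp_apply (f := isometryPow V _), ← LinearIsometry.coe_mul,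
      ← isometryPow_add hV]
    have hadd : (fun i => ((e c + fun i => (j k i : ZMod (2 * D))) i).val)
        = (fun i => (c i : ℕ)) + j k := by
      funext i
      have := hj k hk i
      simp only [e, Pi.add_apply, ← Nat.cast_add]
      exact hval _ (by omega)
    rw [← hadd]
  have hle : (D : ℝ) ^ s * ‖∑ k ∈ t, a k • isometryPow V (j k) f‖ ^ 2
      ≤ B * (((2 * D) ^ s : ℕ) * ‖f‖ ^ 2) := by
    refine le_trans (le_of_eq ?_) (le_trans (Finset.sum_le_univ_sum_of_nonneg
      (s := Finset.univ.map ⟨e, he⟩) fun c => by positivity) h)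
    rw [Finset.sum_map]
    simp only [Function.Embedding.coeFn_mk, hterm]
    simp
  have hDs : (0 : ℝ) < (D : ℝ) ^ s := by positivity
  refine le_of_mul_le_mul_left (hle.trans (le_of_eq ?_)) hDs
  push_cast
  rw [mul_pow]
  ring

/-! ### Smoothness of `ℓ^{2m}` -/

/-- The sum `C` and the difference `S` of the powers satisfy `C' = P C + t S` and `S' = P S + t C`;
both bounds follow by induction along this recursion. -/
theorem mul_pow_add_sub_pow_bounds {P t : ℝ} (ht : |t| ≤ P) (m : ℕ) :
    0 ≤ t * ((P + t) ^ m - (P - t) ^ m) ∧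
      P * (t * ((P + t) ^ m - (P - t) ^ m)) ≤ m * t ^ 2 * ((P + t) ^ m + (P - t) ^ m) := by
  obtain ⟨h1, h2⟩ := abs_le.1 ht
  have hP : 0 ≤ P := (abs_nonneg t).trans ht
  induction m with
  | zero => simp
  | succ m ih =>
    obtain ⟨ih1, ih2⟩ := ih
    have hC : 0 ≤ (P + t) ^ m + (P - t) ^ m := by
      have : 0 ≤ P + t := by linarith
      have : 0 ≤ P - t := by linarith
      positivity
    set C := (P + t) ^ m + (P - t) ^ m with hCdef
    set S := (P + t) ^ m - (P - t) ^ m with hSdef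
    have e1 : (P + t) ^ (m + 1) - (P - t) ^ (m + 1) = P * S + t * C := by
      rw [hCdef, hSdef]; ring
    have e2 : (P + t) ^ (m + 1) + (P - t) ^ (m + 1) = P * C + t * S := by
      rw [hCdef, hSdef]; ring
    rw [e1, e2]
    have ht2 : 0 ≤ t ^ 2 * C := by positivity
    constructor
    · nlinarith [mul_nonneg hP ih1]
    · push_cast
      nlinarith [mul_nonneg hP ih1, mul_le_mul_of_nonneg_left ih2 hP,
        mul_nonneg (mul_nonneg (Nat.cast_nonneg (α := ℝ) m) (sq_nonneg t)) ih1,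
        mul_nonneg (sq_nonneg t) ih1]

/-- The two-point inequality behind the `2`-uniform smoothness of `ℓ^{2m}`. -/
theorem norm_add_pow_add_norm_sub_pow_le (a b : ℂ) {κ : ℝ} (m : ℕ) (hκ : 4 * m + 1 ≤ κ) :
    ‖a + b‖ ^ (2 * m) + ‖a - b‖ ^ (2 * m) ≤ 2 * (‖a‖ ^ 2 + κ * ‖b‖ ^ 2) ^ m := by
  have hadd : ‖a + b‖ ^ 2 = ‖a‖ ^ 2 + ‖b‖ ^ 2 + 2 * inner ℝ a b := by
    rw [norm_add_sq_real]; ring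
  have hsub : ‖a - b‖ ^ 2 = ‖a‖ ^ 2 + ‖b‖ ^ 2 - 2 * inner ℝ a b := by
    rw [norm_sub_sq_real]; ring
  have hin := abs_real_inner_le_norm a b
  rw [pow_mul, pow_mul, hadd, hsub]
  set t := 2 * inner ℝ a b with ht
  set x := ‖a‖
  set y := ‖b‖
  have hx : 0 ≤ x := norm_nonneg a
  have hy : 0 ≤ y := norm_nonneg b
  have htxy : |t| ≤ 2 * (x * y) := by rw [ht, abs_mul, abs_two]; linarith
  have htP : |t| ≤ x ^ 2 + y ^ 2 := htxy.trans (by nlinarith [sq_nonneg (x - y)])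
  set P := x ^ 2 + y ^ 2 with hP
  have ht2 : t ^ 2 ≤ 4 * y ^ 2 * P := by
    have : t ^ 2 ≤ (2 * (x * y)) ^ 2 :=
      sq_le_sq' (by linarith [neg_abs_le t]) (by linarith [le_abs_self t])
    rw [hP]
    nlinarith [sq_nonneg (y ^ 2)]
  have hP0 : 0 ≤ P := by positivity
  obtain ⟨h1, h2⟩ := abs_le.1 htP
  have hCpos : ∀ n, 0 ≤ (P + t) ^ n + (P - t) ^ n := fun n => by
    have : 0 ≤ P + t := by linarith
    have : 0 ≤ P - t := by linarith
    positivity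
  rcases hP0.eq_or_lt with h0 | h0
  · have hy0 : y ^ 2 = 0 := by nlinarith [sq_nonneg x, sq_nonneg y]
    have hx0 : x ^ 2 = 0 := by nlinarith [sq_nonneg x, sq_nonneg y]
    have ht0 : t = 0 := by rw [← h0] at htP; exact abs_nonpos_iff.1 htP
    rw [← h0, ht0, hx0, hy0]
    simp
    linarith
  -- The left side is `x² + (4n + 1) y²`, which explains the threshold `4m + 1` for `κ`.
  have hκy : ∀ n ≤ m, P + 4 * n * y ^ 2 ≤ x ^ 2 + κ * y ^ 2 := by
    intro n hn
    have : (n : ℝ) ≤ m := by exact_mod_cast hn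
    rw [hP]
    nlinarith [sq_nonneg y]
  suffices h : ∀ n ≤ m, (P + t) ^ n + (P - t) ^ n ≤ 2 * (x ^ 2 + κ * y ^ 2) ^ n from h m le_rfl
  intro n hn
  induction n with
  | zero => norm_num
  | succ n ih =>
    have ih := ih (by omega)
    have haux := (mul_pow_add_sub_pow_bounds htP n).2
    set S := (P + t) ^ n - (P - t) ^ n with hS
    set C := (P + t) ^ n + (P - t) ^ n with hC
    have hC0 : 0 ≤ C := hCpos n
    have e2 : (P + t) ^ (n + 1) + (P - t) ^ (n + 1) = P * C + t * S := by
      rw [hC, hS]; ring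
    -- Here `P t S ≤ n t² C` and `t² ≤ 4 y² P`; dividing by `P` gives `t S ≤ 4 n y² C`.
    have hstep : P * C + t * S ≤ (P + 4 * n * y ^ 2) * C := by
      refine le_of_mul_le_mul_left ?_ h0
      nlinarith [mul_le_mul_of_nonneg_right ht2 (mul_nonneg (Nat.cast_nonneg (α := ℝ) n) hC0)]
    rw [e2]
    calc P * C + t * S ≤ (P + 4 * n * y ^ 2) * C := hstep
      _ ≤ (x ^ 2 + κ * y ^ 2) * (2 * (x ^ 2 + κ * y ^ 2) ^ n) :=
        mul_le_mul (hκy n (by omega)) ih hC0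
          ((by positivity : (0 : ℝ) ≤ P + 4 * n * y ^ 2).trans (hκy n (by omega)))
      _ = _ := by ring

theorem PiLp.norm_pow_eq_sum {ι : Type*} [Fintype ι] {n : ℕ} (hn : n ≠ 0)
    [Fact (1 ≤ (n : ℝ≥0∞))] (x : PiLp (n : ℝ≥0∞) fun _ : ι => ℂ) :
    ‖x‖ ^ n = ∑ i, ‖x i‖ ^ n := by
  rw [PiLp.norm_eq_of_nat n rfl, one_div, Real.rpow_inv_natCast_pow (by positivity) hn]

/-- The `2`-uniform smoothness of `ℓ^{2m}`, with a constant of order `m`. -/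
theorem PiLp.norm_add_sq_add_norm_sub_sq_le {ι : Type*} [Fintype ι] {m : ℕ} (hm : m ≠ 0)
    [Fact (1 ≤ ((2 * m : ℕ) : ℝ≥0∞))] (x y : PiLp ((2 * m : ℕ) : ℝ≥0∞) fun _ : ι => ℂ) :
    ‖x + y‖ ^ 2 + ‖x - y‖ ^ 2 ≤ 2 * (‖x‖ ^ 2 + (4 * m + 1) * ‖y‖ ^ 2) := by
  have h2m : 2 * m ≠ 0 := by omega
  have hm1 : (1 : ℝ) ≤ m := by exact_mod_cast Nat.one_le_iff_ne_zero.2 hm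
  set κ : ℝ := 4 * m + 1 with hκ
  have hκ0 : 0 ≤ κ := by positivity
  -- Minkowski's inequality in `ℓ^m` for the squared coordinates.
  have hmink : ∑ i, (‖x i‖ ^ 2 + κ * ‖y i‖ ^ 2) ^ m ≤ (‖x‖ ^ 2 + κ * ‖y‖ ^ 2) ^ m := by
    have h := Real.Lp_add_le_of_nonneg (s := Finset.univ) (p := (m : ℝ)) hm1
      (f := fun i => ‖x i‖ ^ 2) (g := fun i => κ * ‖y i‖ ^ 2)
      (fun i _ => by positivity) (fun i _ => by positivity)
    simp only [Real.rpow_natCast] at h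
    simp only [mul_pow κ, ← pow_mul, ← Finset.mul_sum] at h
    rw [← PiLp.norm_pow_eq_sum h2m, ← PiLp.norm_pow_eq_sum h2m, pow_mul ‖x‖, pow_mul ‖y‖,
      ← mul_pow, one_div, Real.pow_rpow_inv_natCast (by positivity) hm,
      Real.pow_rpow_inv_natCast (by positivity) hm] at h
    have h0 : 0 ≤ ∑ i, (‖x i‖ ^ 2 + κ * ‖y i‖ ^ 2) ^ m :=
      Finset.sum_nonneg fun i _ => by positivity
    calc _ = ((∑ i, (‖x i‖ ^ 2 + κ * ‖y i‖ ^ 2) ^ m) ^ ((m : ℝ)⁻¹)) ^ m :=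
          (Real.rpow_inv_natCast_pow h0 hm).symm
      _ ≤ _ := pow_le_pow_left₀ (by positivity) h m
  have hsum : (‖x + y‖ ^ 2) ^ m + (‖x - y‖ ^ 2) ^ m ≤ 2 * (‖x‖ ^ 2 + κ * ‖y‖ ^ 2) ^ m := by
    rw [← pow_mul, ← pow_mul, PiLp.norm_pow_eq_sum h2m, PiLp.norm_pow_eq_sum h2m,
      ← Finset.sum_add_distrib]
    calc _ ≤ ∑ i, 2 * (‖x i‖ ^ 2 + κ * ‖y i‖ ^ 2) ^ m :=
          Finset.sum_le_sum fun i _ => norm_add_pow_add_norm_sub_pow_le _ _ m le_rfl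
      _ ≤ _ := by rw [← Finset.mul_sum]; linarith
  have hpow : ((‖x + y‖ ^ 2 + ‖x - y‖ ^ 2)) ^ m ≤ (2 * (‖x‖ ^ 2 + κ * ‖y‖ ^ 2)) ^ m := by
    refine (add_pow_le (by positivity) (by positivity) m).trans ?_
    calc _ ≤ 2 ^ (m - 1) * (2 * (‖x‖ ^ 2 + κ * ‖y‖ ^ 2) ^ m) := by gcongr
      _ = 2 ^ (m - 1 + 1) * (‖x‖ ^ 2 + κ * ‖y‖ ^ 2) ^ m := by ring
      _ = _ := by rw [Nat.sub_add_cancel (Nat.one_le_iff_ne_zero.2 hm), mul_pow]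
  exact le_of_pow_le_pow_left₀ hm (by positivity) hpow

/-! ### Type `2` inequality and maxima of random sums -/

section TypeTwo
variable {Ω : Type*} [MeasurableSpace Ω] {μ : Measure Ω} [IsProbabilityMeasure μ]
  {E : Type*} [NormedAddCommGroup E] [NormedSpace ℝ E] [CompleteSpace E] [MeasurableSpace E]
  [BorelSpace E] [SecondCountableTopology E]

theorem lintegral_enorm_sq_eq_eLpNorm_sq {α F : Type*} [MeasurableSpace α] [NormedAddCommGroup F]
    {ν : Measure α} (f : α → F) : ∫⁻ x, ‖f x‖ₑ ^ 2 ∂ν = eLpNorm f 2 ν ^ 2 := by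
  have h := eLpNorm_nnreal_pow_eq_lintegral (f := f) (μ := ν) (p := 2) two_ne_zero
  norm_num at h
  exact h.symm

/-- Adding an independent centered random vector does not decrease the second moment. -/
theorem lintegral_enorm_sq_le_lintegral_enorm_sub_sq {S Z : Ω → E} (hS : AEMeasurable S μ)
    (hZ : MemLp Z 2 μ) (hZ0 : ∫ ω, Z ω ∂μ = 0) (hind : IndepFun S Z μ) :
    ∫⁻ ω, ‖S ω‖ₑ ^ 2 ∂μ ≤ ∫⁻ ω, ‖S ω - Z ω‖ₑ ^ 2 ∂μ := by
  have hZm : AEMeasurable Z μ := hZ.1.aemeasurable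
  have hmap := (indepFun_iff_map_prod_eq_prod_map_map hS hZm).1 hind
  have : IsProbabilityMeasure (μ.map Z) := Measure.isProbabilityMeasure_map hZm
  have : IsProbabilityMeasure (μ.map S) := Measure.isProbabilityMeasure_map hS
  have h1 : ∫⁻ ω, ‖S ω - Z ω‖ₑ ^ 2 ∂μ = ∫⁻ x, ∫⁻ ω, ‖x - Z ω‖ₑ ^ 2 ∂μ ∂(μ.map S) := by
    have hmeas : Measurable fun p : E × E => ‖p.1 - p.2‖ₑ ^ 2 := by fun_prop
    rw [← lintegral_map' (f := fun p : E × E => ‖p.1 - p.2‖ₑ ^ 2) (g := fun ω => (S ω, Z ω))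
      hmeas.aemeasurable (hS.prodMk hZm), hmap, lintegral_prod _ hmeas.aemeasurable]
    refine lintegral_congr fun x => ?_
    rw [lintegral_map' (f := fun z : E => ‖x - z‖ₑ ^ 2) (by fun_prop) hZm]
  rw [h1, ← lintegral_map' (f := fun x : E => ‖x‖ₑ ^ 2) (by fun_prop) hS]
  refine lintegral_mono fun x => ?_
  have hZ1 : Integrable Z μ := hZ.integrable (by norm_num)
  -- With `S` frozen at `x` by independence, centering and Jensen's inequality suffice.
  have h2 : x = ∫ ω, (x - Z ω) ∂μ := by
    rw [integral_sub (integrable_const _) hZ1, hZ0]; simp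
  have h3 : ‖x‖ₑ ≤ eLpNorm (fun ω => x - Z ω) 2 μ := by
    conv_lhs => rw [h2]
    refine (enorm_integral_le_lintegral_enorm _).trans ?_
    rw [← eLpNorm_one_eq_lintegral_enorm]
    exact eLpNorm_le_eLpNorm_of_exponent_le (by norm_num)
      ((aestronglyMeasurable_const).sub hZ.1)
  calc ‖x‖ₑ ^ 2 ≤ eLpNorm (fun ω => x - Z ω) 2 μ ^ 2 := by gcongr
    _ = _ := (lintegral_enorm_sq_eq_eLpNorm_sq _).symm

/-- In a `2`-smooth space second moments are subadditive up to a constant when an independent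
centered vector is added. -/
theorem lintegral_enorm_add_sq_le {κ : ℝ≥0}
    (hE : ∀ x y : E, ‖x + y‖ ^ 2 + ‖x - y‖ ^ 2 ≤ 2 * (‖x‖ ^ 2 + κ * ‖y‖ ^ 2))
    {S Z : Ω → E} (hS : MemLp S 2 μ)
    (hZ : MemLp Z 2 μ) (hZ0 : ∫ ω, Z ω ∂μ = 0) (hind : IndepFun S Z μ) :
    ∫⁻ ω, ‖S ω + Z ω‖ₑ ^ 2 ∂μ ≤ ∫⁻ ω, ‖S ω‖ₑ ^ 2 ∂μ + 2 * κ * ∫⁻ ω, ‖Z ω‖ₑ ^ 2 ∂μ := by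
  have hfin : ∫⁻ ω, ‖S ω‖ₑ ^ 2 ∂μ ≠ ∞ := by
    rw [lintegral_enorm_sq_eq_eLpNorm_sq]
    exact ENNReal.pow_ne_top hS.2.ne
  have hEe : ∀ x y : E, ‖x + y‖ₑ ^ 2 + ‖x - y‖ₑ ^ 2 ≤ 2 * ‖x‖ₑ ^ 2 + 2 * κ * ‖y‖ₑ ^ 2 := by
    intro x y
    have h : ‖x + y‖₊ ^ 2 + ‖x - y‖₊ ^ 2 ≤ 2 * ‖x‖₊ ^ 2 + 2 * κ * ‖y‖₊ ^ 2 := by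
      rw [← NNReal.coe_le_coe]
      push_cast
      linarith [hE x y]
    simp only [enorm_eq_nnnorm]
    exact_mod_cast h
  have hSm := hS.1.aemeasurable
  have hZm := hZ.1.aemeasurable
  have h := lintegral_enorm_sq_le_lintegral_enorm_sub_sq hSm hZ hZ0 hind
  -- The added `∫ ‖S‖²` is replaced by the larger `∫ ‖S - Z‖²`, to which smoothness applies; one
  -- copy of `∫ ‖S‖²` then cancels.
  refine (ENNReal.add_le_add_iff_right hfin).1 ?_
  calc ∫⁻ ω, ‖S ω + Z ω‖ₑ ^ 2 ∂μ + ∫⁻ ω, ‖S ω‖ₑ ^ 2 ∂μ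
      ≤ ∫⁻ ω, ‖S ω + Z ω‖ₑ ^ 2 ∂μ + ∫⁻ ω, ‖S ω - Z ω‖ₑ ^ 2 ∂μ := by gcongr
    _ = ∫⁻ ω, ‖S ω + Z ω‖ₑ ^ 2 + ‖S ω - Z ω‖ₑ ^ 2 ∂μ :=
        (lintegral_add_left' (by fun_prop) _).symm
    _ ≤ ∫⁻ ω, 2 * ‖S ω‖ₑ ^ 2 + 2 * κ * ‖Z ω‖ₑ ^ 2 ∂μ := lintegral_mono fun ω => hEe _ _
    _ = _ := by
      rw [lintegral_add_left' (by fun_prop), lintegral_const_mul'' _ (by fun_prop),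
        lintegral_const_mul'' _ (by fun_prop)]
      ring

/-- Type `2` inequality for sums of independent centered vectors in a `2`-smooth space. -/
theorem lintegral_enorm_sum_sq_le {κ : ℝ≥0}
    (hE : ∀ x y : E, ‖x + y‖ ^ 2 + ‖x - y‖ ^ 2 ≤ 2 * (‖x‖ ^ 2 + κ * ‖y‖ ^ 2))
    {Z : ℕ → Ω → E} (hZ : ∀ n, MemLp (Z n) 2 μ) (hZ0 : ∀ n, ∫ ω, Z n ω ∂μ = 0)
    (hind : iIndepFun Z μ) (t : Finset ℕ) :
    ∫⁻ ω, ‖∑ k ∈ t, Z k ω‖ₑ ^ 2 ∂μ ≤ 2 * κ * ∑ k ∈ t, ∫⁻ ω, ‖Z k ω‖ₑ ^ 2 ∂μ := by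
  classical
  induction t using Finset.induction_on with
  | empty => simp
  | insert k t hk ih =>
    have hi : IndepFun (fun ω => ∑ n ∈ t, Z n ω) (Z k) μ := by
      have := hind.indepFun_finsetSum_of_notMem₀ (fun n => (hZ n).1.aemeasurable) hk
      convert this using 1
      ext ω
      simp
    have h := lintegral_enorm_add_sq_le hE (memLp_finsetSum t fun n _ => hZ n) (hZ k) (hZ0 k) hi
    simp only [Finset.sum_insert hk, add_comm (Z k _)]
    refine h.trans ?_
    rw [mul_add, add_comm]
    gcongr

end TypeTwo

/-- The maximum over `N ≤ 2 ^ m` indices of a sum of independent centered random variables with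
bounded coefficients has a second moment of order `m` times the sum of the variances. -/
theorem lintegral_iSup_enorm_sum_sq_le {Ω : Type*} [MeasurableSpace Ω] {μ : Measure Ω}
    [IsProbabilityMeasure μ] {X : ℕ → Ω → ℂ} (hL2 : ∀ n, MemLp (X n) 2 μ)
    (hcentered : ∀ n, ∫ ω, X n ω ∂μ = 0) (hindep : iIndepFun X μ)
    {ι : Type*} [Fintype ι] {m : ℕ} (hm : m ≠ 0) (hcard : Fintype.card ι ≤ 2 ^ m)
    (e : ℕ → ι → ℂ) (he : ∀ k i, ‖e k i‖ ≤ 1) (t : Finset ℕ) :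
    ∫⁻ ω, (⨆ i, ‖∑ k ∈ t, X k ω * e k i‖ₑ ^ 2) ∂μ ≤
      20 * m * ∑ k ∈ t, eLpNorm (X k) 2 μ ^ 2 := by
  have h2m : 2 * m ≠ 0 := by omega
  have hfact : Fact (1 ≤ ((2 * m : ℕ) : ℝ≥0∞)) := ⟨by exact_mod_cast Nat.one_le_iff_ne_zero.2 h2m⟩
  let E := PiLp ((2 * m : ℕ) : ℝ≥0∞) fun _ : ι => ℂ
  let v : ℕ → E := fun k => WithLp.toLp _ (e k)
  -- The exponent `2m` is matched to the cardinality: `‖v k‖^{2m} ≤ 2^m`.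
  have hv : ∀ k, ‖v k‖ₑ ^ 2 ≤ 2 := by
    intro k
    have h1 : ‖v k‖ ^ (2 * m) ≤ 2 ^ m := by
      rw [PiLp.norm_pow_eq_sum h2m]
      calc ∑ i, ‖v k i‖ ^ (2 * m) ≤ ∑ _i : ι, (1 : ℝ) :=
            Finset.sum_le_sum fun i _ => pow_le_one₀ (norm_nonneg _) (he k i)
        _ ≤ 2 ^ m := by simp; exact_mod_cast hcard
    rw [pow_mul] at h1
    have h2 : ‖v k‖ ^ 2 ≤ 2 := le_of_pow_le_pow_left₀ hm (by norm_num) h1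
    have h3 : ‖v k‖₊ ^ 2 ≤ 2 := by exact_mod_cast h2
    rw [enorm_eq_nnnorm]
    exact_mod_cast h3
  let Z : ℕ → Ω → E := fun k ω => X k ω • v k
  have hZ : ∀ n, MemLp (Z n) 2 μ := fun n =>
    (hL2 n).continuousLinearMap_comp (ContinuousLinearMap.toSpanSingleton ℂ (v n))
  have hZ0 : ∀ n, ∫ ω, Z n ω ∂μ = 0 := fun n => by
    simp only [Z]
    rw [integral_smul_const, hcentered, zero_smul]
  have hind : iIndepFun Z μ := hindep.comp (fun k x => x • v k) fun k => by fun_prop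
  have hE := fun x y : E => PiLp.norm_add_sq_add_norm_sub_sq_le hm x y
  have h := lintegral_enorm_sum_sq_le (κ := 4 * m + 1) (by push_cast; exact hE) hZ hZ0 hind t
  calc ∫⁻ ω, (⨆ i, ‖∑ k ∈ t, X k ω * e k i‖ₑ ^ 2) ∂μ
      ≤ ∫⁻ ω, ‖∑ k ∈ t, Z k ω‖ₑ ^ 2 ∂μ := by
        refine lintegral_mono fun ω => iSup_le fun i => ?_
        have := PiLp.enorm_apply_le (∑ k ∈ t, Z k ω) i
        gcongr
        refine le_trans (le_of_eq ?_) this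
        simp [Z, v, WithLp.ofLp_sum]
        rfl
    _ ≤ _ := h
    _ ≤ 2 * (5 * m) * ∑ k ∈ t, eLpNorm (X k) 2 μ ^ 2 * 2 := by
        gcongr with k
        · have : 4 * m + 1 ≤ 5 * m := by omega
          exact_mod_cast this
        · simp only [Z, enorm_smul, mul_pow]
          rw [lintegral_mul_const'']
          · rw [lintegral_enorm_sq_eq_eLpNorm_sq]
            gcongr
            exact hv k
          · exact ((hL2 k).1.enorm.pow_const 2)
    _ = _ := by rw [← Finset.sum_mul]; ring

/-! ### Decomposition of initial segments into blocks -/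

theorem enorm_sum_sq_le_card_mul {κ : Type*} (t : Finset κ) (u : κ → ℂ) :
    ‖∑ i ∈ t, u i‖ₑ ^ 2 ≤ t.card * ∑ i ∈ t, ‖u i‖ₑ ^ 2 := by
  have h : ‖∑ i ∈ t, u i‖₊ ^ 2 ≤ t.card * ∑ i ∈ t, ‖u i‖₊ ^ 2 :=
    (pow_le_pow_left₀ zero_le (nnnorm_sum_le t u) 2).trans sq_sum_le_card_mul_sum_sq
  simp only [enorm_eq_nnnorm]
  exact_mod_cast h

theorem sum_inv_succ_sq_le_two (t : Finset ℕ) : ∑ i ∈ t, (((i : ℝ) + 1) ^ 2)⁻¹ ≤ 2 := by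
  have h : ∀ n : ℕ, ∑ i ∈ Finset.range (n + 1), (((i : ℝ) + 1) ^ 2)⁻¹ ≤ 2 - ((n : ℝ) + 1)⁻¹ := by
    intro n
    induction n with
    | zero => norm_num
    | succ n ih =>
      rw [Finset.sum_range_succ]
      have h1 : ((((n + 1 : ℕ) : ℝ) + 1) ^ 2)⁻¹ ≤ ((n : ℝ) + 1)⁻¹ - (((n + 1 : ℕ) : ℝ) + 1)⁻¹ := by
        have hn : (0 : ℝ) ≤ n := n.cast_nonneg
        push_cast
        rw [inv_sub_inv (by positivity) (by positivity), inv_eq_one_div,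
          div_le_div_iff₀ (by positivity) (by positivity)]
        nlinarith
      linarith
  obtain ⟨n, hn⟩ := t.exists_nat_subset_range
  calc ∑ i ∈ t, (((i : ℝ) + 1) ^ 2)⁻¹ ≤ ∑ i ∈ Finset.range (n + 1), (((i : ℝ) + 1) ^ 2)⁻¹ :=
        Finset.sum_le_sum_of_subset_of_nonneg
          (hn.trans (Finset.range_mono n.le_succ)) fun i _ _ => by positivity
    _ ≤ 2 - ((n : ℝ) + 1)⁻¹ := h n
    _ ≤ 2 := by
      have : (0 : ℝ) ≤ ((n : ℝ) + 1)⁻¹ := by positivity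
      linarith

/-- Cauchy–Schwarz against the summable weights `(i + 1)⁻²` makes the bound independent of the
number of terms. -/
theorem enorm_sum_sq_le_weighted (t : Finset ℕ) (u : ℕ → ℂ) :
    ‖∑ i ∈ t, u i‖ₑ ^ 2 ≤ 2 * ∑ i ∈ t, ((i : ℝ≥0∞) + 1) ^ 2 * ‖u i‖ₑ ^ 2 := by
  have h1 : ‖∑ i ∈ t, u i‖ ^ 2 ≤ 2 * ∑ i ∈ t, ((i : ℝ) + 1) ^ 2 * ‖u i‖ ^ 2 := by
    calc ‖∑ i ∈ t, u i‖ ^ 2 ≤ (∑ i ∈ t, ‖u i‖) ^ 2 := by gcongr; exact norm_sum_le _ _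
      _ ≤ (∑ i ∈ t, (((i : ℝ) + 1) ^ 2)⁻¹) * ∑ i ∈ t, ((i : ℝ) + 1) ^ 2 * ‖u i‖ ^ 2 := by
        refine Finset.sum_sq_le_sum_mul_sum_of_sq_le_mul t (fun i _ => by positivity)
          (fun i _ => by positivity) fun i _ => ?_
        exact (inv_mul_cancel_left₀ (by positivity) _).ge
      _ ≤ _ := by gcongr; exact sum_inv_succ_sq_le_two t
  have h : ‖∑ i ∈ t, u i‖₊ ^ 2 ≤ 2 * ∑ i ∈ t, ((i : ℝ≥0) + 1) ^ 2 * ‖u i‖₊ ^ 2 := by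
    rw [← NNReal.coe_le_coe]
    push_cast
    exact h1
  simp only [enorm_eq_nnnorm]
  exact_mod_cast h

/-- A partial sum over an initial segment is a sum over at most `r` dyadic blocks. -/
theorem enorm_sum_filter_lt_sq_le (F : Finset ℕ) (u : ℕ → ℂ) {N r : ℕ} (hN : N < 2 ^ r) :
    ‖∑ k ∈ F with k + 1 < N, u k‖ₑ ^ 2 ≤ r * ∑ i ∈ Finset.range r, ∑ c ∈ Finset.range (2 ^ r),
      ‖∑ k ∈ F with (k + 1) / 2 ^ i = c, u k‖ₑ ^ 2 := by
  -- The cutoff `N` is rounded down to a multiple of `2^i`. Passing from `i` to `i + 1` removes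
  -- nothing or one block of length `2^i`, according to the `i`-th binary digit of `N`.
  let g : ℕ → ℂ := fun i => ∑ k ∈ F with (k + 1) / 2 ^ i < N / 2 ^ i, u k
  have hg0 : g 0 = ∑ k ∈ F with k + 1 < N, u k := by simp [g]
  have hgr : g r = 0 := by simp [g, Nat.div_eq_of_lt hN]
  have htel : ∑ k ∈ F with k + 1 < N, u k = ∑ i ∈ Finset.range r, (g i - g (i + 1)) := by
    rw [Finset.sum_range_sub', hg0, hgr, sub_zero]
  rw [htel]
  refine (enorm_sum_sq_le_card_mul _ _).trans ?_
  rw [Finset.card_range]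
  gcongr with i hi
  have hdiv : ∀ m : ℕ, m / 2 ^ (i + 1) = m / 2 ^ i / 2 := fun m => by
    rw [pow_succ, Nat.div_div_eq_div_mul]
  rcases Nat.even_or_odd' (N / 2 ^ i) with ⟨c, hc | hc⟩
  · have : g (i + 1) = g i := by
      simp only [g]
      congr 1
      ext k
      simp only [Finset.mem_filter, and_congr_right_iff, hdiv]
      intro _
      omega
    simp [this]
  · have h1 : g i - g (i + 1) = ∑ k ∈ F with (k + 1) / 2 ^ i = 2 * c, u k := by
      simp only [g, Finset.sum_filter, ← Finset.sum_sub_distrib]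
      refine Finset.sum_congr rfl fun k _ => ?_
      rw [hdiv, hdiv, hc]
      split_ifs <;> first | (exfalso; omega) | simp
    have hmem : 2 * c ∈ Finset.range (2 ^ r) := by
      have := Nat.div_le_self N (2 ^ i)
      rw [Finset.mem_range]
      omega
    rw [h1]
    exact Finset.single_le_sum (f := fun c => ‖∑ k ∈ F with (k + 1) / 2 ^ i = c, u k‖ₑ ^ 2)
      (fun _ _ => zero_le) hmem

/-- The indices `k` with `q k = a` for which `a` is at most of the order of `log k`. -/
def levelBlock (q : ℕ → ℕ) (a : ℕ) : Finset ℕ :=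
  {k ∈ Finset.range (2 ^ 2 ^ (a + 1)) | q k = a ∧ a ≤ 2 * (Nat.log 2 (k + 1) + 1)}

/-- The range in `levelBlock` serves only finiteness; `hq` makes it redundant. -/
theorem mem_levelBlock {q : ℕ → ℕ} (hq : ∀ k, k < 2 ^ 2 ^ (q k + 1)) {a k : ℕ} :
    k ∈ levelBlock q a ↔ q k = a ∧ q k ≤ 2 * (Nat.log 2 (k + 1) + 1) := by
  simp only [levelBlock, Finset.mem_filter, Finset.mem_range]
  constructor
  · rintro ⟨-, rfl, h⟩
    exact ⟨rfl, h⟩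
  · rintro ⟨rfl, h⟩
    exact ⟨hq k, rfl, h⟩

/-- The part of a level block in the dyadic interval `[2 ^ b, 2 ^ (b + 1))`, shifted by one. -/
def dyadicBlock (q : ℕ → ℕ) (a b : ℕ) : Finset ℕ :=
  {k ∈ levelBlock q a | Nat.log 2 (k + 1) = b}

/-- The weighted sum of a set function over the index sets into which every initial segment of `ℕ`
is decomposed: exceptional points, level blocks, dyadic blocks, and dyadic subintervals of these. -/
noncomputable def chainSum (q : ℕ → ℕ) (N : Finset ℕ → ℝ≥0∞) : ℝ≥0∞ :=
  (∑' k : ℕ, ((k : ℝ≥0∞) + 1) ^ 2 * N {l ∈ {k} | 2 * (Nat.log 2 (l + 1) + 1) < q l}) +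
  ((∑' a : ℕ, ((a : ℝ≥0∞) + 1) ^ 2 * N (levelBlock q a)) +
  ((∑' a : ℕ, ∑' b : ℕ, ((b : ℝ≥0∞) + 1) ^ 2 * N (dyadicBlock q a b)) +
  (∑' a : ℕ, ∑' b : ℕ, ((b + 2 : ℕ) : ℝ≥0∞) * ∑ i ∈ Finset.range (b + 2),
    ∑ c ∈ Finset.range (2 ^ (b + 2)), N {k ∈ dyadicBlock q a b | (k + 1) / 2 ^ i = c})))

theorem enorm_add_sq_le_two_mul (x y : ℂ) : ‖x + y‖ₑ ^ 2 ≤ 2 * ‖x‖ₑ ^ 2 + 2 * ‖y‖ₑ ^ 2 := by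
  have h := enorm_sum_sq_le_card_mul Finset.univ ![x, y]
  simpa [Fin.sum_univ_two, mul_add] using h

/-- Every partial sum of a series is controlled by the weighted square sum over the blocks into
which initial segments are decomposed. -/
theorem enorm_sum_range_sq_le_chainSum {q : ℕ → ℕ} (hmono : Monotone q)
    (hq : ∀ k, k < 2 ^ 2 ^ (q k + 1)) (u : ℕ → ℂ) (n : ℕ) :
    ‖∑ k ∈ Finset.range (n + 1), u k‖ₑ ^ 2 ≤ 16 * chainSum q fun F => ‖∑ k ∈ F, u k‖ₑ ^ 2 := by
  set p : ℕ → ℕ := fun k => Nat.log 2 (k + 1) with hp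
  have hpm : Monotone p := fun a b h => Nat.log_mono_right (by omega)
  set T : ℕ → Prop := fun k => 2 * (p k + 1) < q k with hT
  -- `x₁` collects the exceptional indices, `x₂` the complete levels below `q n`, `x₃` the complete
  -- dyadic blocks of level `q n`, and `x₄` the last dyadic block, cut at `n`.
  set x₁ := ∑ k ∈ Finset.range (n + 1), ∑ l ∈ {l ∈ ({k} : Finset ℕ) | T l}, u l with hx₁
  set x₂ := ∑ a ∈ Finset.range (q n), ∑ k ∈ levelBlock q a, u k with hx₂
  set x₃ := ∑ b ∈ Finset.range (p n), ∑ k ∈ dyadicBlock q (q n) b, u k with hx₃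
  set x₄ := ∑ k ∈ dyadicBlock q (q n) (p n) with k + 1 < n + 2, u k with hx₄
  have hlast : ∑ k ∈ levelBlock q (q n) with k ≤ n, u k = x₃ + x₄ := by
    rw [← Finset.sum_fiberwise_of_maps_to (t := Finset.range (p n + 1)) (g := p),
      Finset.sum_range_succ]
    · congr 1
      · refine Finset.sum_congr rfl fun b hb => Finset.sum_congr ?_ fun _ _ => rfl
        ext k
        simp only [dyadicBlock, Finset.mem_filter, Finset.mem_range] at hb ⊢
        constructor
        · rintro ⟨⟨h1, h2⟩, h3⟩
          exact ⟨h1, h3⟩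
        · rintro ⟨h1, h3⟩
          refine ⟨⟨h1, ?_⟩, h3⟩
          by_contra hc
          have : p n ≤ p k := hpm (by omega)
          simp only [hp] at this hb
          omega
      · refine Finset.sum_congr ?_ fun _ _ => rfl
        ext k
        simp only [dyadicBlock, Finset.mem_filter, hp]
        constructor
        · rintro ⟨⟨h1, h2⟩, h3⟩
          exact ⟨⟨h1, h3⟩, by omega⟩
        · rintro ⟨⟨h1, h3⟩, h2⟩
          exact ⟨⟨h1, by omega⟩, h3⟩
    · intro k hk
      have := hpm (Finset.mem_filter.1 hk).2
      simpa [Nat.lt_succ_iff] using this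
  have hU : ∑ k ∈ Finset.range (n + 1) with ¬ T k, u k = x₂ + (x₃ + x₄) := by
    rw [← hlast, ← Finset.sum_fiberwise_of_maps_to (t := Finset.range (q n + 1)) (g := q),
      Finset.sum_range_succ]
    · congr 1
      · refine Finset.sum_congr rfl fun a ha => Finset.sum_congr ?_ fun _ _ => rfl
        ext k
        simp only [mem_levelBlock hq, Finset.mem_filter, Finset.mem_range, hT, not_lt, hp] at ha ⊢
        constructor
        · rintro ⟨⟨h1, h2⟩, h3⟩
          exact ⟨h3, h2⟩
        · rintro ⟨h3, h2⟩
          refine ⟨⟨?_, h2⟩, h3⟩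
          by_contra hc
          have := hmono (show n ≤ k by omega)
          omega
      · refine Finset.sum_congr ?_ fun _ _ => rfl
        ext k
        simp only [mem_levelBlock hq, Finset.mem_filter, Finset.mem_range, hT, not_lt, hp]
        constructor
        · rintro ⟨⟨h1, h2⟩, h3⟩
          exact ⟨⟨h3, h2⟩, by omega⟩
        · rintro ⟨⟨h3, h2⟩, h1⟩
          exact ⟨⟨by omega, h2⟩, h3⟩
    · intro k hk
      have := (Finset.mem_range.1 (Finset.mem_filter.1 hk).1)
      have := hmono (show k ≤ n by omega)
      simpa [Nat.lt_succ_iff] using this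
  have hsum : ∑ k ∈ Finset.range (n + 1), u k = x₁ + (x₂ + (x₃ + x₄)) := by
    rw [← hU, ← Finset.sum_filter_add_sum_filter_not _ T]
    congr 1
    rw [hx₁, Finset.sum_filter]
    refine Finset.sum_congr rfl fun k _ => ?_
    rw [Finset.sum_filter, Finset.sum_singleton]
  have h₁ : ‖x₁‖ₑ ^ 2 ≤ 2 * ∑' k : ℕ, ((k : ℝ≥0∞) + 1) ^ 2 *
      ‖∑ l ∈ {l ∈ ({k} : Finset ℕ) | 2 * (Nat.log 2 (l + 1) + 1) < q l}, u l‖ₑ ^ 2 := by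
    refine (enorm_sum_sq_le_weighted _ _).trans ?_
    gcongr
    exact ENNReal.sum_le_tsum _
  have h₂ : ‖x₂‖ₑ ^ 2 ≤ 2 * ∑' a : ℕ, ((a : ℝ≥0∞) + 1) ^ 2 * ‖∑ k ∈ levelBlock q a, u k‖ₑ ^ 2 := by
    refine (enorm_sum_sq_le_weighted _ _).trans ?_
    gcongr
    exact ENNReal.sum_le_tsum _
  have h₃ : ‖x₃‖ₑ ^ 2 ≤ 2 * ∑' a : ℕ, ∑' b : ℕ, ((b : ℝ≥0∞) + 1) ^ 2 *
      ‖∑ k ∈ dyadicBlock q a b, u k‖ₑ ^ 2 := by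
    refine (enorm_sum_sq_le_weighted _ _).trans ?_
    gcongr
    refine (ENNReal.sum_le_tsum _).trans ?_
    exact ENNReal.le_tsum (f := fun a => ∑' b : ℕ, ((b : ℝ≥0∞) + 1) ^ 2 *
      ‖∑ k ∈ dyadicBlock q a b, u k‖ₑ ^ 2) (q n)
  have h₄ : ‖x₄‖ₑ ^ 2 ≤ ∑' a : ℕ, ∑' b : ℕ, ((b + 2 : ℕ) : ℝ≥0∞) * ∑ i ∈ Finset.range (b + 2),
      ∑ c ∈ Finset.range (2 ^ (b + 2)),
        ‖∑ k ∈ {k ∈ dyadicBlock q a b | (k + 1) / 2 ^ i = c}, u k‖ₑ ^ 2 := by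
    -- The cutoff is `n + 2` because blocks are indexed by `k + 1`; hence `b + 2` dyadic scales.
    have hN : n + 2 < 2 ^ (p n + 2) := by
      have := Nat.lt_pow_succ_log_self one_lt_two (n + 1)
      rw [pow_succ]
      simp only [hp, Nat.succ_eq_add_one] at this ⊢
      omega
    refine (enorm_sum_filter_lt_sq_le _ u hN).trans ?_
    refine le_trans ?_ (ENNReal.le_tsum (q n))
    exact ENNReal.le_tsum (f := fun b => ((b + 2 : ℕ) : ℝ≥0∞) * ∑ i ∈ Finset.range (b + 2),
      ∑ c ∈ Finset.range (2 ^ (b + 2)),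
        ‖∑ k ∈ {k ∈ dyadicBlock q (q n) b | (k + 1) / 2 ^ i = c}, u k‖ₑ ^ 2) (p n)
  rw [hsum, chainSum]
  set A₁ := ∑' k : ℕ, ((k : ℝ≥0∞) + 1) ^ 2 *
      ‖∑ l ∈ {l ∈ ({k} : Finset ℕ) | 2 * (Nat.log 2 (l + 1) + 1) < q l}, u l‖ₑ ^ 2
  set A₂ := ∑' a : ℕ, ((a : ℝ≥0∞) + 1) ^ 2 * ‖∑ k ∈ levelBlock q a, u k‖ₑ ^ 2
  set A₃ := ∑' a : ℕ, ∑' b : ℕ, ((b : ℝ≥0∞) + 1) ^ 2 * ‖∑ k ∈ dyadicBlock q a b, u k‖ₑ ^ 2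
  set A₄ := ∑' a : ℕ, ∑' b : ℕ, ((b + 2 : ℕ) : ℝ≥0∞) * ∑ i ∈ Finset.range (b + 2),
      ∑ c ∈ Finset.range (2 ^ (b + 2)),
        ‖∑ k ∈ {k ∈ dyadicBlock q a b | (k + 1) / 2 ^ i = c}, u k‖ₑ ^ 2
  calc ‖x₁ + (x₂ + (x₃ + x₄))‖ₑ ^ 2
      ≤ 2 * ‖x₁‖ₑ ^ 2 + 2 * (2 * ‖x₂‖ₑ ^ 2 + 2 * (2 * ‖x₃‖ₑ ^ 2 + 2 * ‖x₄‖ₑ ^ 2)) := by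
        refine (enorm_add_sq_le_two_mul _ _).trans ?_
        gcongr
        refine (enorm_add_sq_le_two_mul _ _).trans ?_
        gcongr
        exact enorm_add_sq_le_two_mul _ _
    _ ≤ 2 * (2 * A₁) + 2 * (2 * (2 * A₂) + 2 * (2 * (2 * A₃) + 2 * A₄)) := by gcongr
    _ = 4 * A₁ + 8 * A₂ + 16 * A₃ + 8 * A₄ := by ring
    _ ≤ 16 * A₁ + 16 * A₂ + 16 * A₃ + 16 * A₄ := by gcongr <;> norm_num
    _ = _ := by ring

theorem chainSum_mono {q : ℕ → ℕ} {N N' : Finset ℕ → ℝ≥0∞} (h : ∀ F, N F ≤ N' F) :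
    chainSum q N ≤ chainSum q N' := by
  unfold chainSum
  gcongr <;> exact h _

theorem chainSum_mul_right (q : ℕ → ℕ) (N : Finset ℕ → ℝ≥0∞) (c : ℝ≥0∞) :
    chainSum q (fun F => N F * c) = chainSum q N * c := by
  simp only [chainSum, ← mul_assoc, ← Finset.sum_mul, ENNReal.tsum_mul_right, add_mul]

theorem aemeasurable_chainSum {α : Type*} [MeasurableSpace α] {ν : Measure α} (q : ℕ → ℕ)
    {N : Finset ℕ → α → ℝ≥0∞} (hN : ∀ F, AEMeasurable (N F) ν) :
    AEMeasurable (fun x => chainSum q fun F => N F x) ν := by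
  unfold chainSum
  fun_prop

/-- Used twice, over `Y` and over `Ω`, to reduce to second moments on single blocks. -/
theorem lintegral_chainSum {α : Type*} [MeasurableSpace α] {ν : Measure α} (q : ℕ → ℕ)
    {N : Finset ℕ → α → ℝ≥0∞} (hN : ∀ F, AEMeasurable (N F) ν) :
    ∫⁻ x, chainSum q (fun F => N F x) ∂ν = chainSum q fun F => ∫⁻ x, N F x ∂ν := by
  unfold chainSum
  rw [lintegral_add_left' (by fun_prop), lintegral_add_left' (by fun_prop),
    lintegral_add_left' (by fun_prop), lintegral_tsum (by fun_prop), lintegral_tsum (by fun_prop),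
    lintegral_tsum (by fun_prop), lintegral_tsum (by fun_prop)]
  congr 1
  · refine tsum_congr fun k => lintegral_const_mul'' _ (hN _)
  congr 1
  · refine tsum_congr fun k => lintegral_const_mul'' _ (hN _)
  congr 1
  · refine tsum_congr fun a => ?_
    rw [lintegral_tsum (by fun_prop)]
    exact tsum_congr fun k => lintegral_const_mul'' _ (hN _)
  · refine tsum_congr fun a => ?_
    rw [lintegral_tsum (by fun_prop)]
    refine tsum_congr fun b => ?_
    rw [lintegral_const_mul'' _ (by fun_prop), lintegral_finsetSum' _ (by fun_prop)]
    congr 1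
    refine Finset.sum_congr rfl fun i _ => ?_
    rw [lintegral_finsetSum' _ (by fun_prop)]

theorem ENNReal.tsum_sum_le_tsum_of_fiber {κ : Type*} [DecidableEq κ] (F : κ → Finset ℕ) (g : ℕ → κ)
    (hF : ∀ i, ∀ k ∈ F i, g k = i) (x : ℕ → ℝ≥0∞) :
    ∑' i, ∑ k ∈ F i, x k ≤ ∑' k, x k := by
  have h : ∀ i, ∑ k ∈ F i, x k ≤ ∑' k, if g k = i then x k else 0 := fun i => by
    refine le_trans (Finset.sum_le_sum fun k hk => ?_) (ENNReal.sum_le_tsum (F i))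
    rw [if_pos (hF i k hk)]
  refine (ENNReal.tsum_le_tsum h).trans ?_
  rw [ENNReal.tsum_comm]
  refine ENNReal.tsum_le_tsum fun k => ?_
  rw [tsum_eq_single (g k) fun i hi => if_neg hi.symm, if_pos rfl]

theorem ENNReal.tsum_sum_filter_eq_le {κ : Type*} [DecidableEq κ] (F : Finset ℕ) (g : ℕ → κ)
    (x : ℕ → ℝ≥0∞) : ∑' i, ∑ k ∈ F with g k = i, x k ≤ ∑ k ∈ F, x k := by
  have h := ENNReal.tsum_sum_le_tsum_of_fiber (fun i => {k ∈ F | g k = i}) g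
    (fun i k hk => (Finset.mem_filter.1 hk).2) (fun k => if k ∈ F then x k else 0)
  rw [tsum_eq_sum (s := F) fun k hk => if_neg hk, Finset.sum_congr rfl fun k hk => if_pos hk] at h
  refine le_trans (le_of_eq (tsum_congr fun i => Finset.sum_congr rfl fun k hk => ?_)) h
  rw [if_pos (Finset.mem_filter.1 hk).1]

/-- A set function that is additively bounded with constant of order `2 ^ a` on level `a` has a
weighted block sum of order `∑ 2 ^ q k * (log k) ^ 2 * τ k`. -/
theorem chainSum_le {q : ℕ → ℕ} {N : Finset ℕ → ℝ≥0∞} {τ : ℕ → ℝ≥0∞} {A : ℝ≥0∞}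
    (hsingle : ∀ k, N {k} ≤ τ k) (hempty : N ∅ = 0)
    (hlevel : ∀ a F, (∀ k ∈ F, q k = a) → F ⊆ levelBlock q a → N F ≤ A * 2 ^ a * ∑ k ∈ F, τ k) :
    chainSum q N ≤
      (1 + 14 * A) * ∑' k : ℕ, 2 ^ q k * ((Nat.log 2 (k + 1) + 1 : ℕ) : ℝ≥0∞) ^ 2 * τ k := by
  set p : ℕ → ℕ := fun k => Nat.log 2 (k + 1) with hp
  set y : ℕ → ℝ≥0∞ := fun k => 2 ^ q k * ((p k + 1 : ℕ) : ℝ≥0∞) ^ 2 * τ k with hy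
  have hlevel' : ∀ a F, F ⊆ levelBlock q a → N F ≤ A * ∑ k ∈ F, 2 ^ q k * τ k := by
    intro a F hF
    have hqa : ∀ k ∈ F, q k = a := fun k hk => (Finset.mem_filter.1 (hF hk)).2.1
    refine (hlevel a F hqa hF).trans (le_of_eq ?_)
    rw [mul_assoc, Finset.mul_sum]
    congr 1
    exact Finset.sum_congr rfl fun k hk => by rw [hqa k hk]
  have hblocks : ∑' a, ∑ k ∈ levelBlock q a, y k ≤ ∑' k, y k :=
    ENNReal.tsum_sum_le_tsum_of_fiber _ q (fun a k hk => (Finset.mem_filter.1 hk).2.1) y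
  -- At an exceptional index `2^{q k} ≥ (k + 1)²`, so the level weight alone absorbs the
  -- Cauchy–Schwarz weight.
  have h₁ : ∑' k : ℕ, ((k : ℝ≥0∞) + 1) ^ 2 *
      N {l ∈ {k} | 2 * (Nat.log 2 (l + 1) + 1) < q l} ≤ ∑' k, y k := by
    refine ENNReal.tsum_le_tsum fun k => ?_
    rw [Finset.filter_singleton]
    split_ifs with hk
    · have h1 : (k + 1) ^ 2 ≤ 2 ^ q k := by
        have := (Nat.lt_pow_succ_log_self one_lt_two (k + 1)).le
        calc (k + 1) ^ 2 ≤ (2 ^ (Nat.log 2 (k + 1) + 1)) ^ 2 := Nat.pow_le_pow_left this 2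
          _ = 2 ^ (2 * (Nat.log 2 (k + 1) + 1)) := by rw [← pow_mul, mul_comm]
          _ ≤ 2 ^ q k := Nat.pow_le_pow_right (by norm_num) hk.le
      have h2 : ((k : ℝ≥0∞) + 1) ^ 2 ≤ 2 ^ q k := by exact_mod_cast h1
      have h3 : (1 : ℝ≥0∞) ≤ ((p k + 1 : ℕ) : ℝ≥0∞) ^ 2 := by
        exact_mod_cast Nat.one_le_pow _ _ (Nat.succ_pos _)
      calc ((k : ℝ≥0∞) + 1) ^ 2 * N {k} ≤ 2 ^ q k * 1 * τ k := by
            rw [mul_one]; gcongr; exact hsingle k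
        _ ≤ y k := by simp only [hy]; gcongr
    · rw [hempty]; simp
  have h₂ : ∑' a : ℕ, ((a : ℝ≥0∞) + 1) ^ 2 * N (levelBlock q a) ≤ 9 * A * ∑' k, y k := by
    calc _ ≤ ∑' a : ℕ, 9 * A * ∑ k ∈ levelBlock q a, y k := by
          refine ENNReal.tsum_le_tsum fun a => ?_
          calc ((a : ℝ≥0∞) + 1) ^ 2 * N (levelBlock q a)
              ≤ ((a : ℝ≥0∞) + 1) ^ 2 * (A * ∑ k ∈ levelBlock q a, 2 ^ q k * τ k) := by
                gcongr
                exact hlevel' a _ subset_rfl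
            _ = A * ∑ k ∈ levelBlock q a, ((a : ℝ≥0∞) + 1) ^ 2 * (2 ^ q k * τ k) := by
                rw [Finset.mul_sum, Finset.mul_sum, Finset.mul_sum]
                exact Finset.sum_congr rfl fun k _ => by ring
            _ ≤ A * ∑ k ∈ levelBlock q a, 9 * y k := by
                refine mul_le_mul' le_rfl (Finset.sum_le_sum fun k hk => ?_)
                have hk2 := (Finset.mem_filter.1 hk).2.2
                have h1 : (a + 1) ^ 2 ≤ 9 * (p k + 1) ^ 2 := by
                  calc (a + 1) ^ 2 ≤ (3 * (p k + 1)) ^ 2 :=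
                        Nat.pow_le_pow_left (by simp only [hp]; omega) 2
                    _ = _ := by ring
                have h2 : ((a : ℝ≥0∞) + 1) ^ 2 ≤ 9 * ((p k + 1 : ℕ) : ℝ≥0∞) ^ 2 := by
                  exact_mod_cast h1
                calc ((a : ℝ≥0∞) + 1) ^ 2 * (2 ^ q k * τ k)
                    ≤ 9 * ((p k + 1 : ℕ) : ℝ≥0∞) ^ 2 * (2 ^ q k * τ k) := by gcongr
                  _ = 9 * y k := by simp only [hy]; ring
            _ = _ := by rw [← Finset.mul_sum]; ring
      _ ≤ _ := by rw [ENNReal.tsum_mul_left]; gcongr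
  have hdy : ∀ a, ∑' b, ∑ k ∈ dyadicBlock q a b, y k ≤ ∑ k ∈ levelBlock q a, y k := fun a =>
    ENNReal.tsum_sum_filter_eq_le _ p y
  have hpb : ∀ a b, ∀ k ∈ dyadicBlock q a b, p k = b := fun a b k hk => (Finset.mem_filter.1 hk).2
  have hy' : ∀ a b, ∑ k ∈ dyadicBlock q a b, y k =
      ((b + 1 : ℕ) : ℝ≥0∞) ^ 2 * ∑ k ∈ dyadicBlock q a b, 2 ^ q k * τ k := by
    intro a b
    rw [Finset.mul_sum]
    refine Finset.sum_congr rfl fun k hk => ?_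
    simp only [hy, hpb a b k hk]
    ring
  have h₃ : ∑' a : ℕ, ∑' b : ℕ, ((b : ℝ≥0∞) + 1) ^ 2 * N (dyadicBlock q a b) ≤
      A * ∑' k, y k := by
    calc _ ≤ ∑' a, ∑' b, A * ∑ k ∈ dyadicBlock q a b, y k := by
          refine ENNReal.tsum_le_tsum fun a => ENNReal.tsum_le_tsum fun b => ?_
          rw [hy', mul_left_comm]
          push_cast
          gcongr
          exact hlevel' a _ (Finset.filter_subset _ _)
      _ ≤ ∑' a, A * ∑ k ∈ levelBlock q a, y k := by
          refine ENNReal.tsum_le_tsum fun a => ?_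
          rw [ENNReal.tsum_mul_left]
          gcongr
          exact hdy a
      _ ≤ _ := by rw [ENNReal.tsum_mul_left]; gcongr
  -- Blocks of one scale `i` are disjoint. The `b + 2` scales and the outer factor give `(b + 2)² ≤
  -- 4 (b + 1)²`.
  have h₄ : ∑' a : ℕ, ∑' b : ℕ, ((b + 2 : ℕ) : ℝ≥0∞) * ∑ i ∈ Finset.range (b + 2),
      ∑ c ∈ Finset.range (2 ^ (b + 2)), N {k ∈ dyadicBlock q a b | (k + 1) / 2 ^ i = c} ≤
      4 * A * ∑' k, y k := by
    calc _ ≤ ∑' a, ∑' b, 4 * A * ∑ k ∈ dyadicBlock q a b, y k := by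
          refine ENNReal.tsum_le_tsum fun a => ENNReal.tsum_le_tsum fun b => ?_
          have hi : ∀ i, ∑ c ∈ Finset.range (2 ^ (b + 2)),
              N {k ∈ dyadicBlock q a b | (k + 1) / 2 ^ i = c} ≤
              A * ∑ k ∈ dyadicBlock q a b, 2 ^ q k * τ k := by
            intro i
            calc _ ≤ ∑ c ∈ Finset.range (2 ^ (b + 2)),
                  A * ∑ k ∈ dyadicBlock q a b with (k + 1) / 2 ^ i = c, 2 ^ q k * τ k :=
                  Finset.sum_le_sum fun c _ => hlevel' a _
                    ((Finset.filter_subset _ _).trans (Finset.filter_subset _ _))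
              _ ≤ _ := by
                  rw [← Finset.mul_sum]
                  gcongr
                  exact (ENNReal.sum_le_tsum _).trans
                    (ENNReal.tsum_sum_filter_eq_le _ (fun k => (k + 1) / 2 ^ i) _)
          calc _ ≤ ((b + 2 : ℕ) : ℝ≥0∞) * ∑ i ∈ Finset.range (b + 2),
                A * ∑ k ∈ dyadicBlock q a b, 2 ^ q k * τ k := by
                gcongr with i _
                exact hi i
            _ = ((b + 2 : ℕ) : ℝ≥0∞) ^ 2 * (A * ∑ k ∈ dyadicBlock q a b, 2 ^ q k * τ k) := by
                rw [Finset.sum_const, Finset.card_range, nsmul_eq_mul]; ring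
            _ ≤ (4 * ((b + 1 : ℕ) : ℝ≥0∞) ^ 2) *
                  (A * ∑ k ∈ dyadicBlock q a b, 2 ^ q k * τ k) := by
                gcongr
                have : (b + 2) ^ 2 ≤ 4 * (b + 1) ^ 2 := by
                  calc (b + 2) ^ 2 ≤ (2 * (b + 1)) ^ 2 := Nat.pow_le_pow_left (by omega) 2
                    _ = _ := by ring
                exact_mod_cast this
            _ = _ := by rw [hy']; ring
      _ ≤ ∑' a, 4 * A * ∑ k ∈ levelBlock q a, y k := by
          refine ENNReal.tsum_le_tsum fun a => ?_
          rw [ENNReal.tsum_mul_left]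
          gcongr
          exact hdy a
      _ ≤ _ := by rw [ENNReal.tsum_mul_left]; gcongr
  unfold chainSum
  calc _ ≤ ∑' k, y k + (9 * A * ∑' k, y k + (A * ∑' k, y k + 4 * A * ∑' k, y k)) := by gcongr
    _ = _ := by ring

/-! ### Random bounds uniform in the isometries -/

/-- A random polynomial of degree less than `2 ^ 2 ^ (a + 1)` in commuting isometries has a norm
whose second moment is of order `2 ^ a` times the sum of the variances of its coefficients,
uniformly in the isometries. -/
theorem exists_bound_sum_isometryPow {Ω : Type*} [MeasurableSpace Ω] {μ : Measure Ω}
    [IsProbabilityMeasure μ] {s : ℕ} {X : ℕ → Ω → ℂ} {j : ℕ → Fin s → ℕ}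
    (hL2 : ∀ n, MemLp (X n) 2 μ) (hcentered : ∀ n, ∫ ω, X n ω ∂μ = 0) (hindep : iIndepFun X μ)
    (F : Finset ℕ) (a : ℕ) (hj : ∀ k ∈ F, ∀ i, j k i < 2 ^ 2 ^ (a + 1)) :
    ∃ h : Ω → ℝ≥0∞, AEMeasurable h μ ∧
      ∫⁻ ω, h ω ∂μ ≤ 2 ^ s * (20 * (4 * s + 1)) * 2 ^ a * ∑ k ∈ F, eLpNorm (X k) 2 μ ^ 2 ∧
      ∀ (ω : Ω) (Y : Type*) [MeasurableSpace Y] (ν : Measure Y)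
        (V : Fin s → (Lp ℂ 2 ν →ₗᵢ[ℂ] Lp ℂ 2 ν)), (∀ i k, Commute (V i) (V k)) →
        ∀ f : Lp ℂ 2 ν,
          ‖∑ k ∈ F, X k ω • isometryPow V (j k) f‖ₑ ^ 2 ≤ h ω * ‖f‖ₑ ^ 2 := by
  set D := 2 ^ 2 ^ (a + 1) with hD
  have hD0 : NeZero D := ⟨by positivity⟩
  let G := Fin s → ZMod (2 * D)
  let e : ℕ → AddChar G ℂ → ℂ := fun k χ => χ (-fun i => (j k i : ZMod (2 * D)))
  -- The extra `+ 1` keeps the exponent nonzero when `s = 0`.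
  have hcard : Fintype.card (AddChar G ℂ) ≤ 2 ^ (s * 2 ^ (a + 2) + 1) := by
    rw [AddChar.card_eq, Fintype.card_fun, ZMod.card, Fintype.card_fin, hD, ← pow_succ', ← pow_mul]
    refine Nat.pow_le_pow_right (by norm_num) ?_
    have h1 : 1 ≤ 2 ^ (a + 1) := Nat.one_le_two_pow
    calc (2 ^ (a + 1) + 1) * s ≤ (2 ^ (a + 1) + 2 ^ (a + 1)) * s := by gcongr
      _ = s * 2 ^ (a + 2) := by ring
      _ ≤ _ := Nat.le_succ _
  have he : ∀ k χ, ‖e k χ‖ ≤ 1 := fun k χ => (AddChar.norm_apply χ _).le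
  have hmax := lintegral_iSup_enorm_sum_sq_le hL2 hcentered hindep (Nat.succ_ne_zero _) hcard e he F
  have hXm : ∀ k, AEMeasurable (X k) μ := fun k => (hL2 k).1.aemeasurable
  have hmeas : AEMeasurable (fun ω => ⨆ χ, ‖∑ k ∈ F, X k ω * e k χ‖ₑ ^ 2) μ :=
    AEMeasurable.iSup fun χ => by fun_prop
  refine ⟨fun ω => 2 ^ s * ⨆ χ, ‖∑ k ∈ F, X k ω * e k χ‖ₑ ^ 2, hmeas.const_mul _, ?_, ?_⟩
  · rw [lintegral_const_mul'' _ hmeas, mul_assoc (2 ^ s * _), mul_assoc (2 ^ s)]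
    gcongr
    refine hmax.trans ?_
    rw [← mul_assoc]
    refine mul_le_mul' ?_ le_rfl
    have h1 : 1 ≤ 2 ^ a := Nat.one_le_two_pow
    have h2 : 20 * (s * 2 ^ (a + 2) + 1) ≤ 20 * (4 * s + 1) * 2 ^ a := by
      calc 20 * (s * 2 ^ (a + 2) + 1) ≤ 20 * (s * 2 ^ (a + 2) + 2 ^ a) := by gcongr
        _ = _ := by ring
    exact_mod_cast h2
  · intro ω Y _ ν V hV f
    obtain ⟨χ₀, hχ₀⟩ := Finite.exists_max fun χ => ‖∑ k ∈ F, X k ω * e k χ‖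
    have h := norm_sq_sum_isometryPow_le hV F (fun k => X k ω) hj
      (B := ‖∑ k ∈ F, X k ω * e k χ₀‖ ^ 2)
      (fun χ => pow_le_pow_left₀ (norm_nonneg _) (hχ₀ χ) 2) f
    have h' : ‖∑ k ∈ F, X k ω • isometryPow V (j k) f‖₊ ^ 2 ≤
        2 ^ s * ‖∑ k ∈ F, X k ω * e k χ₀‖₊ ^ 2 * ‖f‖₊ ^ 2 := by
      rw [← NNReal.coe_le_coe]
      push_cast
      exact h
    have h'' : ‖∑ k ∈ F, X k ω • isometryPow V (j k) f‖ₑ ^ 2 ≤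
        2 ^ s * ‖∑ k ∈ F, X k ω * e k χ₀‖ₑ ^ 2 * ‖f‖ₑ ^ 2 := by
      simp only [enorm_eq_nnnorm]
      exact_mod_cast h'
    refine h''.trans ?_
    exact mul_le_mul' (mul_le_mul' le_rfl
      (le_iSup (fun χ => ‖∑ k ∈ F, X k ω * e k χ‖ₑ ^ 2) χ₀)) le_rfl

theorem Lp.coeFn_sum_smul {Y : Type*} [MeasurableSpace Y] {ν : Measure Y} (F : Finset ℕ)
    (c : ℕ → ℂ) (g : ℕ → Lp ℂ 2 ν) :
    (∑ k ∈ F, c k • g k : Lp ℂ 2 ν) =ᵐ[ν] fun y => ∑ k ∈ F, c k * g k y := by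
  classical
  induction F using Finset.induction_on with
  | empty =>
    simp only [Finset.sum_empty]
    exact Lp.coeFn_zero ℂ 2 ν
  | insert k t hk ih =>
    simp only [Finset.sum_insert hk]
    filter_upwards [Lp.coeFn_add (c k • g k) (∑ k ∈ t, c k • g k), Lp.coeFn_smul (c k) (g k), ih]
      with y h1 h2 h3
    rw [h1, Pi.add_apply, h2, h3, Pi.smul_apply, smul_eq_mul]

theorem enorm_sum_isometryPow_le {Y : Type*} [MeasurableSpace Y] {ν : Measure Y} {s : ℕ}
    (V : Fin s → (Lp ℂ 2 ν →ₗᵢ[ℂ] Lp ℂ 2 ν)) (F : Finset ℕ) (c : ℕ → ℂ) (j : ℕ → Fin s → ℕ)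
    (f : Lp ℂ 2 ν) :
    ‖∑ k ∈ F, c k • isometryPow V (j k) f‖ₑ ^ 2 ≤ (∑ k ∈ F, ‖c k‖ₑ) ^ 2 * ‖f‖ₑ ^ 2 := by
  rw [← mul_pow]
  gcongr
  refine (enorm_sum_le _ _).trans (le_of_eq ?_)
  rw [Finset.sum_mul]
  refine Finset.sum_congr rfl fun k _ => ?_
  rw [enorm_smul, ← ofReal_norm (isometryPow V (j k) f), LinearIsometry.norm_map, ofReal_norm]

/-- The maximal inequality for random weighted sums, with a random constant that does not depend on
the isometries. -/
theorem exists_bound_iSup_weightedSum {Ω : Type*} [MeasurableSpace Ω] {μ : Measure Ω}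
    [IsProbabilityMeasure μ] {s : ℕ} {X : ℕ → Ω → ℂ} {j : ℕ → Fin s → ℕ}
    (hL2 : ∀ n, MemLp (X n) 2 μ) (hcentered : ∀ n, ∫ ω, X n ω ∂μ = 0) (hindep : iIndepFun X μ)
    {q : ℕ → ℕ} (hmono : Monotone q) (hq : ∀ k, k < 2 ^ 2 ^ (q k + 1))
    (hj : ∀ k i, j k i < 2 ^ 2 ^ (q k + 1)) :
    ∃ h : Ω → ℝ≥0∞, AEMeasurable h μ ∧
      ∫⁻ ω, h ω ∂μ ≤ 16 * ((1 + 14 * (2 ^ s * (20 * (4 * s + 1)))) *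
        ∑' k : ℕ, 2 ^ q k * ((Nat.log 2 (k + 1) + 1 : ℕ) : ℝ≥0∞) ^ 2 * eLpNorm (X k) 2 μ ^ 2) ∧
      ∀ (ω : Ω) (Y : Type*) [MeasurableSpace Y] (ν : Measure Y)
        (V : Fin s → (Lp ℂ 2 ν →ₗᵢ[ℂ] Lp ℂ 2 ν)), (∀ i k, Commute (V i) (V k)) →
        ∀ f : Lp ℂ 2 ν,
          ∫⁻ y, (⨆ n, ‖weightedSum (fun k => X k ω) V j f n y‖ₑ ^ 2) ∂ν ≤ h ω * ‖f‖ₑ ^ 2 := by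
  have hjF : ∀ F : Finset ℕ, ∀ k ∈ F, ∀ i, j k i < 2 ^ 2 ^ (F.sup q + 1) := by
    intro F k hk i
    refine (hj k i).trans_le ?_
    have : q k ≤ F.sup q := Finset.le_sup hk
    gcongr <;> norm_num
  choose b hbm hbi hb using fun F : Finset ℕ =>
    exists_bound_sum_isometryPow hL2 hcentered hindep F (F.sup q) (hjF F)
  have hXm : ∀ k, AEMeasurable (X k) μ := fun k => (hL2 k).1.aemeasurable
  -- The trivial bound is kept for singletons: at exceptional indices a second factor `2^{q k}`
  -- could not be afforded.
  let N : Finset ℕ → Ω → ℝ≥0∞ := fun F ω => min ((∑ k ∈ F, ‖X k ω‖ₑ) ^ 2) (b F ω)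
  have hNm : ∀ F, AEMeasurable (N F) μ := fun F =>
    AEMeasurable.min (by fun_prop) (hbm F)
  have hN : ∀ (F : Finset ℕ) (ω : Ω) (Y : Type _) [MeasurableSpace Y] (ν : Measure Y)
      (V : Fin s → (Lp ℂ 2 ν →ₗᵢ[ℂ] Lp ℂ 2 ν)), (∀ i k, Commute (V i) (V k)) →
      ∀ f : Lp ℂ 2 ν,
        ‖∑ k ∈ F, X k ω • isometryPow V (j k) f‖ₑ ^ 2 ≤ N F ω * ‖f‖ₑ ^ 2 := by
    intro F ω Y _ ν V hV f
    simp only [N]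
    rcases min_choice ((∑ k ∈ F, ‖X k ω‖ₑ) ^ 2) (b F ω) with h | h
    · rw [h]
      exact enorm_sum_isometryPow_le V F _ j f
    · rw [h]
      exact hb F ω Y ν V hV f
  refine ⟨fun ω => 16 * chainSum q fun F => N F ω, (aemeasurable_chainSum q hNm).const_mul _, ?_, ?_⟩
  · rw [lintegral_const_mul'' _ (aemeasurable_chainSum q hNm), lintegral_chainSum q hNm]
    gcongr
    refine chainSum_le (fun k => ?_) (by simp [N]) fun a F hF _ => ?_
    · rw [← lintegral_enorm_sq_eq_eLpNorm_sq]
      refine lintegral_mono fun ω => ?_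
      simp [N]
    · refine (lintegral_mono fun ω => min_le_right _ _).trans ((hbi F).trans ?_)
      gcongr
      · norm_num
      · exact Finset.sup_le fun k hk => (hF k hk).le
  · intro ω Y _ ν V hV f
    have hF : ∀ F : Finset ℕ, ∫⁻ y, ‖∑ k ∈ F, X k ω * isometryPow V (j k) f y‖ₑ ^ 2 ∂ν ≤
        N F ω * ‖f‖ₑ ^ 2 := by
      intro F
      refine le_trans (le_of_eq ?_) (hN F ω Y ν V hV f)
      rw [lintegral_enorm_sq_eq_eLpNorm_sq, Lp.enorm_def]
      congr 1
      exact (eLpNorm_congr_ae (Lp.coeFn_sum_smul F (fun k => X k ω) _)).symm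
    have hm : ∀ F : Finset ℕ,
        AEMeasurable (fun y => ‖∑ k ∈ F, X k ω * isometryPow V (j k) f y‖ₑ ^ 2) ν := by
      intro F
      have : ∀ k, AEMeasurable (isometryPow V (j k) f) ν := fun k =>
        (Lp.aestronglyMeasurable _).aemeasurable
      fun_prop
    calc ∫⁻ y, (⨆ n, ‖weightedSum (fun k => X k ω) V j f n y‖ₑ ^ 2) ∂ν
        ≤ ∫⁻ y, 16 * chainSum q (fun F => ‖∑ k ∈ F, X k ω * isometryPow V (j k) f y‖ₑ ^ 2) ∂ν :=
          lintegral_mono fun y => iSup_le fun n => enorm_sum_range_sq_le_chainSum hmono hq _ n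
      _ = 16 * chainSum q (fun F => ∫⁻ y, ‖∑ k ∈ F, X k ω * isometryPow V (j k) f y‖ₑ ^ 2 ∂ν) := by
          rw [lintegral_const_mul'' _ (aemeasurable_chainSum q hm), lintegral_chainSum q hm]
      _ ≤ 16 * chainSum q (fun F => N F ω * ‖f‖ₑ ^ 2) := by
          gcongr
          exact chainSum_mono hF
      _ = _ := by rw [chainSum_mul_right, mul_assoc]

/-! ### Comparison with the logarithmic weights of the hypothesis -/

/-- The binary order of magnitude of `log (max (k + 2) (runningMax j k))`. -/
def logLevel {s : ℕ} (j : ℕ → Fin s → ℕ) (k : ℕ) : ℕ :=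
  Nat.log 2 (Nat.log 2 (max (k + 2) (runningMax j k)))

theorem runningMax_mono {s : ℕ} (j : ℕ → Fin s → ℕ) : Monotone (runningMax j) := fun _ _ h =>
  Finset.sup_mono (Finset.range_mono (Nat.succ_le_succ h))

theorem le_runningMax {s : ℕ} (j : ℕ → Fin s → ℕ) (k : ℕ) (i : Fin s) : j k i ≤ runningMax j k :=
  (Finset.le_sup (f := j k) (Finset.mem_univ i)).trans
    (Finset.le_sup (f := fun k => Finset.univ.sup (j k)) (Finset.self_mem_range_succ k))

theorem logLevel_mono {s : ℕ} (j : ℕ → Fin s → ℕ) : Monotone (logLevel j) := fun _ _ h =>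
  Nat.log_mono_right (Nat.log_mono_right (max_le_max (Nat.add_le_add_right h 2)
    (runningMax_mono j h)))

theorem max_lt_two_pow_logLevel {s : ℕ} (j : ℕ → Fin s → ℕ) (k : ℕ) :
    max (k + 2) (runningMax j k) < 2 ^ 2 ^ (logLevel j k + 1) := by
  refine (Nat.lt_pow_succ_log_self one_lt_two _).trans_le (Nat.pow_le_pow_right (by norm_num) ?_)
  exact Nat.lt_pow_succ_log_self one_lt_two _

theorem natLog_two_mul_log_two_le (d : ℕ) (hd : d ≠ 0) :
    (Nat.log 2 d : ℝ) * Real.log 2 ≤ Real.log d := by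
  rw [← Real.log_pow]
  refine Real.log_le_log (by positivity) ?_
  exact_mod_cast Nat.pow_log_le_self 2 hd

theorem logLevel_weight_le {s : ℕ} (j : ℕ → Fin s → ℕ) {k : ℕ} (hk : 1 ≤ k) :
    (2 : ℝ) ^ logLevel j k * ((Nat.log 2 (k + 1) + 1 : ℕ) : ℝ) ^ 2 ≤
      8 / Real.log 2 ^ 3 *
        (Real.log (max ((k : ℝ) + 1) (runningMax j k : ℝ)) * Real.log ((k : ℝ) + 1) ^ 2) := by
  have hl : 0 < Real.log 2 := Real.log_pos one_lt_two
  set d := max (k + 2) (runningMax j k) with hd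
  set M := max ((k : ℝ) + 1) (runningMax j k : ℝ) with hM
  have hk1 : (1 : ℝ) ≤ k := by exact_mod_cast hk
  have hMk : (k : ℝ) + 1 ≤ M := le_max_left _ _
  have h1 : (2 : ℝ) ^ logLevel j k * Real.log 2 ≤ 2 * Real.log M := by
    -- The `k + 2` in `logLevel` makes the inner logarithm nonzero, so the outer one is not a
    -- default value.
    have hd0 : 2 ≤ d := le_trans (by omega) (le_max_left (k + 2) _)
    have h2 : (2 : ℝ) ^ logLevel j k ≤ (Nat.log 2 d : ℝ) := by
      have : Nat.log 2 d ≠ 0 := (Nat.log_pos one_lt_two hd0).ne'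
      exact_mod_cast Nat.pow_log_le_self 2 this
    have h3 : (d : ℝ) ≤ M ^ 2 := by
      rw [hd]
      push_cast
      have : (runningMax j k : ℝ) ≤ M := le_max_right _ _
      exact max_le (by nlinarith) (by nlinarith)
    calc (2 : ℝ) ^ logLevel j k * Real.log 2 ≤ (Nat.log 2 d : ℝ) * Real.log 2 := by gcongr
      _ ≤ Real.log d := natLog_two_mul_log_two_le d (by omega)
      _ ≤ Real.log (M ^ 2) := Real.log_le_log (by exact_mod_cast (by omega : 0 < d)) h3
      _ = 2 * Real.log M := by rw [Real.log_pow]; norm_num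
  have h4 : ((Nat.log 2 (k + 1) + 1 : ℕ) : ℝ) * Real.log 2 ≤ 2 * Real.log ((k : ℝ) + 1) := by
    have hp : 1 ≤ Nat.log 2 (k + 1) := Nat.log_pos one_lt_two (by omega)
    have h5 := natLog_two_mul_log_two_le (k + 1) (by omega)
    push_cast at h5 ⊢
    have : (1 : ℝ) ≤ Nat.log 2 (k + 1) := by exact_mod_cast hp
    nlinarith
  have h6 : ((2 : ℝ) ^ logLevel j k * Real.log 2) *
      (((Nat.log 2 (k + 1) + 1 : ℕ) : ℝ) * Real.log 2) ^ 2 ≤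
      (2 * Real.log M) * (2 * Real.log ((k : ℝ) + 1)) ^ 2 := by
    gcongr
    exact mul_nonneg zero_le_two (Real.log_nonneg (by linarith))
  rw [div_mul_eq_mul_div, le_div_iff₀ (by positivity)]
  nlinarith [h6]

theorem tsum_logLevel_weight_ne_top {s : ℕ} (j : ℕ → Fin s → ℕ) {σ : ℕ → ℝ≥0∞} (hσ : ∀ n, σ n ≠ ∞)
    (hsum : Summable fun n : ℕ =>
      (σ n).toReal ^ 2 * Real.log (max ((n : ℝ) + 1) (runningMax j n : ℝ)) *
        Real.log ((n : ℝ) + 1) ^ 2) :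
    ∑' k : ℕ, 2 ^ logLevel j k * ((Nat.log 2 (k + 1) + 1 : ℕ) : ℝ≥0∞) ^ 2 * σ k ^ 2 ≠ ∞ := by
  have h : Summable fun k : ℕ =>
      (2 : ℝ) ^ logLevel j k * ((Nat.log 2 (k + 1) + 1 : ℕ) : ℝ) ^ 2 * (σ k).toReal ^ 2 := by
    -- At index `0` the weight `log 1` vanishes and gives no control, so that single finite term is
    -- dropped.
    rw [← summable_nat_add_iff 1]
    refine Summable.of_nonneg_of_le (fun k => by positivity) (fun k => ?_)
      (((summable_nat_add_iff 1).2 hsum).mul_left (8 / Real.log 2 ^ 3))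
    have := mul_le_mul_of_nonneg_right (logLevel_weight_le j (Nat.le_add_left 1 k))
      (sq_nonneg (σ (k + 1)).toReal)
    exact this.trans (le_of_eq (by ring))
  refine ne_of_eq_of_ne (tsum_congr fun k => ?_) h.tsum_ofReal_ne_top
  rw [ENNReal.ofReal_mul (by positivity), ENNReal.ofReal_mul (by positivity),
    ENNReal.ofReal_pow (by positivity), ENNReal.ofReal_pow (by positivity),
    ENNReal.ofReal_pow (by positivity), ENNReal.ofReal_toReal (hσ k), ENNReal.ofReal_natCast]
  norm_num

/-! ### Convergence from tail bounds, and the theorem -/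

theorem weightedSum_sub_weightedSum_tail {Y : Type*} [MeasurableSpace Y] {ν : Measure Y} {s : ℕ}
    (c : ℕ → ℂ) (V : Fin s → (Lp ℂ 2 ν →ₗᵢ[ℂ] Lp ℂ 2 ν)) (j : ℕ → Fin s → ℕ) (f : Lp ℂ 2 ν)
    {m n : ℕ} (hmn : m ≤ n) (y : Y) :
    weightedSum c V j f n y - weightedSum c V j f m y =
      weightedSum (fun k => if m ≤ k then c k else 0) V j f n y -
        weightedSum (fun k => if m ≤ k then c k else 0) V j f m y := by
  have h := fun c : ℕ → ℂ => Finset.sum_range_add_sum_Ico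
    (fun k => c k * isometryPow V (j k) f y) (Nat.succ_le_succ hmn)
  simp only [weightedSum, Nat.succ_eq_add_one] at h ⊢
  rw [← h c, ← h fun k => if m ≤ k then c k else 0, add_sub_cancel_left, add_sub_cancel_left]
  refine Finset.sum_congr rfl fun k hk => ?_
  rw [if_pos (by have := (Finset.mem_Ico.1 hk).1; omega)]

theorem cauchySeq_of_iInf_iSup_tail {S : ℕ → ℂ} {T : ℕ → ℕ → ℂ}
    (hST : ∀ m n, m ≤ n → S n - S m = T m n - T m m)
    (h : ⨅ m, ⨆ n, ‖T m n‖ₑ ^ 2 = 0) : CauchySeq S := by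
  rw [Metric.cauchySeq_iff']
  intro ε hε
  have hε' : (0 : ℝ≥0∞) < ENNReal.ofReal (ε / 2) ^ 2 := by
    have : 0 < ENNReal.ofReal (ε / 2) := ENNReal.ofReal_pos.2 (by linarith)
    positivity
  obtain ⟨m, hm⟩ := iInf_lt_iff.1 (h ▸ hε')
  have hT : ∀ n, ‖T m n‖ < ε / 2 := by
    intro n
    have h1 := (le_iSup (fun n => ‖T m n‖ₑ ^ 2) n).trans_lt hm
    have h2 : ‖T m n‖ₑ < ENNReal.ofReal (ε / 2) := lt_of_pow_lt_pow_left' 2 h1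
    rw [← ofReal_norm] at h2
    exact (ENNReal.ofReal_lt_ofReal_iff (by linarith)).1 h2
  refine ⟨m, fun n hn => ?_⟩
  rw [dist_eq_norm, hST m n hn]
  linarith [norm_sub_le (T m n) (T m m), hT n, hT m]

theorem theorem5p1 {Ω : Type*} [MeasurableSpace Ω] (μ : Measure Ω) [IsProbabilityMeasure μ]
    (s : ℕ) (X : ℕ → Ω → ℂ) (j : ℕ → Fin s → ℕ)
    (hL2 : ∀ n, MemLp (X n) 2 μ)
    (hcentered : ∀ n, ∫ ω, X n ω ∂μ = 0)
    (hindep : iIndepFun X μ)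
    (hsum : Summable fun n : ℕ =>
      (eLpNorm (X n) 2 μ).toReal ^ 2 * Real.log (max ((n : ℝ) + 1) (runningMax j n : ℝ)) *
        Real.log ((n : ℝ) + 1) ^ 2) :
    ∀ᵐ ω ∂μ, ∃ K : ℝ≥0,
      ∀ (Y : Type*) [MeasurableSpace Y] (ν : Measure Y) [IsProbabilityMeasure ν]
        (V : Fin s → (Lp ℂ 2 ν →ₗᵢ[ℂ] Lp ℂ 2 ν)), (∀ i k, Commute (V i) (V k)) →
        ∀ f : Lp ℂ 2 ν,
          (∀ᵐ y ∂ν, ∃ l : ℂ,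
            Tendsto (fun n => weightedSum (fun k => X k ω) V j f n y) atTop (𝓝 l)) ∧
          eLpNorm (fun y => ⨆ n : ℕ, ‖weightedSum (fun k => X k ω) V j f n y‖ₑ) 2 ν
            ≤ (K : ℝ≥0∞) * eLpNorm f 2 ν := by
  classical
  -- Truncation keeps centering, independence and the levels, so the maximal inequality applies to
  -- every tail; `m = 0` is the full series.
  let Z : ℕ → ℕ → Ω → ℂ := fun m k ω => if m ≤ k then X k ω else 0
  have hZL2 : ∀ m n, MemLp (Z m n) 2 μ := by
    intro m n
    by_cases hmn : m ≤ n
    · simpa [Z, hmn] using hL2 n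
    · simp [Z, hmn]
  have hZc : ∀ m n, ∫ ω, Z m n ω ∂μ = 0 := by
    intro m n
    by_cases hmn : m ≤ n
    · simpa [Z, hmn] using hcentered n
    · simp [Z, hmn]
  have hZi : ∀ m, iIndepFun (Z m) μ := fun m =>
    hindep.comp (fun k x => if m ≤ k then x else 0) fun k => by
      by_cases hmk : m ≤ k <;> simp [hmk, measurable_id']
  have hq : ∀ k, k < 2 ^ 2 ^ (logLevel j k + 1) := fun k =>
    lt_of_le_of_lt (by omega) (lt_of_le_of_lt (le_max_left (k + 2) _) (max_lt_two_pow_logLevel j k))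
  have hj : ∀ k i, j k i < 2 ^ 2 ^ (logLevel j k + 1) := fun k i =>
    (le_runningMax j k i).trans_lt
      (lt_of_le_of_lt (le_max_right (k + 2) _) (max_lt_two_pow_logLevel j k))
  choose h hm hint hbound using fun m =>
    exists_bound_iSup_weightedSum (hZL2 m) (hZc m) (hZi m) (logLevel_mono j) hq hj
  set W : ℕ → ℝ≥0∞ := fun k =>
    2 ^ logLevel j k * ((Nat.log 2 (k + 1) + 1 : ℕ) : ℝ≥0∞) ^ 2 * eLpNorm (X k) 2 μ ^ 2 with hW
  have hWfin : ∑' k, W k ≠ ∞ := tsum_logLevel_weight_ne_top j (fun n => (hL2 n).2.ne) hsum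
  set C : ℝ≥0∞ := 16 * (1 + 14 * (2 ^ s * (20 * (4 * s + 1)))) with hC
  have hCfin : C ≠ ∞ := by
    rw [hC]
    exact_mod_cast ENNReal.natCast_ne_top (16 * (1 + 14 * (2 ^ s * (20 * (4 * s + 1)))))
  have hint' : ∀ m, ∫⁻ ω, h m ω ∂μ ≤ C * ∑' k, W (k + m) := by
    intro m
    refine (hint m).trans ?_
    rw [← mul_assoc]
    refine mul_le_mul' le_rfl ?_
    rw [← ENNReal.summable.sum_add_tsum_nat_add' (k := m) (f := fun k =>
      2 ^ logLevel j k * ((Nat.log 2 (k + 1) + 1 : ℕ) : ℝ≥0∞) ^ 2 * eLpNorm (Z m k) 2 μ ^ 2),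
      Finset.sum_eq_zero, zero_add]
    · refine le_of_eq (tsum_congr fun k => ?_)
      simp [hW, Z]
    · intro k hk
      have : Z m k = 0 := by
        ext ω
        simp [Z, Finset.mem_range.1 hk]
      simp [this]
  have hlim : Tendsto (fun m => C * ∑' k, W (k + m)) atTop (𝓝 0) := by
    simpa using ENNReal.Tendsto.const_mul (ENNReal.tendsto_sum_nat_add W hWfin) (Or.inr hCfin)
  have hfin0 : ∀ᵐ ω ∂μ, h 0 ω < ∞ := by
    refine ae_lt_top' (hm 0) (ne_top_of_le_ne_top ?_ (hint' 0))
    simpa using ENNReal.mul_ne_top hCfin hWfin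
  -- The means of `h m` tend to `0`, so the infimum has mean `0`; no monotonicity in `m` is needed.
  have hinf : ∀ᵐ ω ∂μ, ⨅ m, h m ω = 0 := by
    have : ∫⁻ ω, ⨅ m, h m ω ∂μ = 0 := by
      refine le_antisymm (ge_of_tendsto' hlim fun m => ?_) zero_le
      exact (lintegral_mono fun ω => iInf_le _ m).trans (hint' m)
    exact (lintegral_eq_zero_iff' (AEMeasurable.iInf hm)).1 this
  filter_upwards [hfin0, hinf] with ω hω₁ hω₂
  -- The exceptional null set and the constant come from the `h m` alone, hence precede the choice
  -- of `Y`, `V` and `f`.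
  refine ⟨NNReal.sqrt (h 0 ω).toNNReal, fun Y _ ν _ V hV f => ⟨?_, ?_⟩⟩
  · have hSm : ∀ m n, AEMeasurable (weightedSum (fun k => Z m k ω) V j f n) ν := by
      intro m n
      have : ∀ k, AEMeasurable (isometryPow V (j k) f) ν := fun k =>
        (Lp.aestronglyMeasurable _).aemeasurable
      unfold weightedSum
      fun_prop
    have hzero : ∫⁻ y, ⨅ m, ⨆ n, ‖weightedSum (fun k => Z m k ω) V j f n y‖ₑ ^ 2 ∂ν = 0 := by
      refine le_antisymm ?_ zero_le
      calc _ ≤ ⨅ m, h m ω * ‖f‖ₑ ^ 2 := le_iInf fun m =>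
            (lintegral_mono fun y => iInf_le _ m).trans (hbound m ω Y ν V hV f)
        _ = (⨅ m, h m ω) * ‖f‖ₑ ^ 2 :=
            (ENNReal.iInf_mul fun h => absurd h (ENNReal.pow_ne_top enorm_ne_top)).symm
        _ = 0 := by rw [hω₂, zero_mul]
    have hae := (lintegral_eq_zero_iff' (AEMeasurable.iInf fun m => AEMeasurable.iSup fun n =>
      (hSm m n).enorm.pow_const 2)).1 hzero
    filter_upwards [hae] with y hy
    exact cauchySeq_tendsto_of_complete (cauchySeq_of_iInf_iSup_tail
      (fun m n hmn => weightedSum_sub_weightedSum_tail (fun k => X k ω) V j f hmn y) hy)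
  · have h0 := hbound 0 ω Y ν V hV f
    simp only [Z, zero_le, if_true] at h0
    have hK : (((NNReal.sqrt (h 0 ω).toNNReal : ℝ≥0) : ℝ≥0∞)) ^ 2 = h 0 ω := by
      rw [← ENNReal.coe_pow, NNReal.sq_sqrt, ENNReal.coe_toNNReal hω₁.ne]
    rw [← ENNReal.pow_le_pow_left_iff two_ne_zero, mul_pow, hK, ← Lp.enorm_def]
    refine le_trans (le_of_eq ?_) h0
    have h2 := eLpNorm_nnreal_pow_eq_lintegral (μ := ν) (p := 2) two_ne_zero
      (f := fun y => ⨆ n : ℕ, ‖weightedSum (fun k => X k ω) V j f n y‖ₑ)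
    norm_num at h2
    rw [h2]
    refine lintegral_congr fun y => ?_
    exact Monotone.map_iSup_of_continuousAt (f := fun x : ℝ≥0∞ => x ^ 2)
      (ENNReal.continuous_pow 2).continuousAt (pow_left_mono 2) (by simp)
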